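/- **Notation.** Let $x_0,x_1,x_2,\dots$ be commuting variables, $[n]=\{1,\dots,n\}$ and $[0,n-1]=\{0,\dots,n-1\}$. For $I\subseteq[0,n-1]$ let \[F^B_I=\sum_{\substack{0=i_0\le i_1\le\cdots\le i_n\\ j\in I\Rightarrow i_j<i_{j+1}}}x_{i_1}\cdots x_{i_n},\qquad \mathrm{Peak}^B(I)=\{p\in[n-1]:p\in I,\ p-1\notin I\},\] and, with $P=\mathrm{Peak}^B(I)$, $J+1=\{j+1:j\in J\}$ and $\triangle$ the symmetric difference, let $\Delta^B(I)$ be the type-$B$ peak function \[\Delta^B(I)=\begin{cases}K_{(0,P)}=2^{|P|}\displaystyle\sum_{J\subseteq[0,n-1],\ P\subseteq J\triangle(J+1)}F^B_J&\text{if }0\notin I,\\[2ex] K_{(1,P)}=2^{|P|+1}\displaystyle\sum_{0\in J\subseteq[0,n-1],\ P\subseteq J\triangle(J+1)}F^B_J&\text{if }0\in I.\end{cases}\] (These depend on $n$.) The *$2$-quotient* $(\mu,\nu)$ of a partition $\lambda=(\lambda_1,\dots,\lambda_k)$ is obtained as follows. Let $\lambda^\star=(\lambda_i+k-i)_{1\le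 i\le k}$. From the even (respectively, odd) entries of $\lambda^\star$, read from right to left, subtract $0,2,4,\dots$ (respectively, $1,3,5,\dots$); divide the results by $2$ and remove zeros. The even entries give $\mu=(\mu_1,\dots,\mu_p)$, and the odd entries give $\nu=(\nu_1,\dots,\nu_q)$. A domino of a domino tiling of the Young diagram of $\lambda$ is *strictly below* the main diagonal if all its cells are, and *weakly above* it otherwise. A domino tiling of $\lambda$ is *shifted* if there is no vertical domino $d$ meeting the main diagonal such that there is at least one domino left of and adjacent to $d$ and all such dominoes are strictly below the main diagonal. A *semistandard shifted domino tableau* of shape $\lambda$ is a filling of the dominoes weakly above the main diagonal in a shifted tiling of $\lambda$ with entries from $\{0<1'<1<2'<2<\cdots\}$ such that entries weakly increase from left to right along rows and from top to bottom in columns; for each $i\ge1$, each row contains at most one $i'$; for each $i\geq 0$, each column contains at most one $i$; and the northwest-most domino may be filled with $0$ only if it is horizontal. Let $\mathsf{SSShDT}(\lambda)$ be the set of these, and for such a $T$ let $x^{\mathrm{wt}(T)}=\prod_i x_i^{\mathrm{wt}_i(T)}$, where $\mathrm{wt}_i(T)$ is the number of entries of $T$ equal to $i$ or $i'$. The *shifted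 domino function* is $H_\lambda=\sum_{T\in\mathsf{SSShDT}(\lambda)}x^{\mathrm{wt}(T)}$. A *standard shifted domino tableau* of shape $\lambda$ is a bijective filling of the dominoes weakly above the main diagonal in a shifted tiling of $\lambda$ with entries in $[m]$, where $m$ is the number of these dominoes, such that entries strictly increase from left to right along rows and from top to bottom in columns. Let $\mathsf{SShDT}(\lambda)$ be the set of these. (Tableaux, standard or semistandard, are identified when they have the same filled dominoes with the same entries.) For $Q\in\mathsf{SShDT}(\lambda)$, the set $\mathrm{Des}(Q)\subseteq[0,m-1]$ contains $0$ if and only if $m\ge1$ and the domino with entry $1$ is vertical; it contains $i\in[m-1]$ if and only if the domino with entry $i+1$ is strictly lower than the domino with entry $i$ (each cell of the former is in a lower row than each cell of the latter). **Corollary.** Let $\lambda$ be a partition whose $2$-quotient $(\mu,\nu)=((\mu_1,\dots,\mu_p),(\nu_1,\dots,\nu_q))$ satisfies $\mu_p\ge p$ (if $p\geq 1$) and $\nu_q\ge q$ (if $q\geq 1$). Then \[H_\lambda=\sum_{Q\in\mathsf{SShDT}(\lambda)}\Delta^B(\mathrm{Des}(Q)),\] where $\Delta^B(\mathrm{Des}(Q))$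 is taken with $n$ equal to the number $m$ of dominoes of $Q$. -/

import Mathlib

namespace ShiftedDomino

/-! ### Generating functions in the variables `x_0, x_1, x_2, …` -/

/-- The formal power series `∑_{a : α} x^{wt a}`: the coefficient of `x^e` is the number of `a`
with `wt a = e`. It is used only for families in which each of these numbers is finite. -/
noncomputable def genFun {α : Type} (wt : α → (ℕ →₀ ℕ)) : MvPowerSeries ℕ ℤ :=
  fun e => (Nat.card {a : α // wt a = e} : ℤ)

/-! ### Type-`B` fundamental quasisymmetric functions and peak functions -/

/-- Sequences `0 = i_0 ≤ i_1 ≤ ⋯ ≤ i_n` with `i_j < i_{j+1}` whenever `j ∈ I`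
(only the elements of `I` in `[0, n-1]` matter). -/
def FundSeq (n : ℕ) (I : Finset ℕ) : Type :=
  {i : Fin (n + 1) → ℕ //
    i 0 = 0 ∧ Monotone i ∧ ∀ j : Fin n, (j : ℕ) ∈ I → i j.castSucc < i j.succ}

/-- The exponent of the monomial `x_{i_1} x_{i_2} ⋯ x_{i_n}`. -/
noncomputable def FundSeq.wt {n : ℕ} {I : Finset ℕ} (i : FundSeq n I) : ℕ →₀ ℕ :=
  ∑ j : Fin n, Finsupp.single (i.1 j.succ) 1

theorem FundSeq.finite_wt_eq (n : ℕ) (I : Finset ℕ) (e : ℕ →₀ ℕ) :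
    Finite {i : FundSeq n I // i.wt = e} := by
  have key : ∀ a : {i : FundSeq n I // i.wt = e}, ∀ j : Fin n, a.1.1 j.succ ∈ e.support := by
    rintro ⟨a, rfl⟩ j
    unfold FundSeq.wt
    rw [Finsupp.mem_support_iff, Finsupp.finsetSum_apply]
    refine ne_of_gt (Finset.sum_pos' (fun _ _ => Nat.zero_le _) ⟨j, Finset.mem_univ _, ?_⟩)
    simp
  refine Finite.of_injective
    (fun a : {i : FundSeq n I // i.wt = e} =>
      fun j : Fin n => (⟨a.1.1 j.succ, key a j⟩ : e.support)) ?_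
  intro a b h
  apply Subtype.ext
  apply Subtype.ext
  funext k
  refine Fin.cases ?_ (fun j => ?_) k
  · rw [a.1.2.1, b.1.2.1]
  · exact congrArg Subtype.val (congrFun h j)

/-- The type-`B` fundamental quasisymmetric function `F^B_I` of degree `n`. -/
noncomputable def fundB (n : ℕ) (I : Finset ℕ) : MvPowerSeries ℕ ℤ :=
  genFun (FundSeq.wt : FundSeq n I → (ℕ →₀ ℕ))

/-- `P ⊆ J △ (J + 1)`. -/
def PeakCompatible (P J : Finset ℕ) : Prop :=
  P ⊆ symmDiff J (J.image (· + 1))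

open Classical in
/-- The type-`B` peak function `K_{(0,P)}` of degree `n`. -/
noncomputable def peakFun0 (n : ℕ) (P : Finset ℕ) : MvPowerSeries ℕ ℤ :=
  2 ^ P.card * ∑ J ∈ (Finset.range n).powerset with PeakCompatible P J, fundB n J

open Classical in
/-- The type-`B` peak function `K_{(1,P)}` of degree `n` (meant for `1 ∉ P`). -/
noncomputable def peakFun1 (n : ℕ) (P : Finset ℕ) : MvPowerSeries ℕ ℤ :=
  2 ^ (P.card + 1) *
    ∑ J ∈ (Finset.range n).powerset with (0 ∈ J ∧ PeakCompatible P J), fundB n J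

/-- The type-`B` peak set `{p ∈ [n-1] : p ∈ I, p - 1 ∉ I}`. -/
def peakSetB (n : ℕ) (I : Finset ℕ) : Finset ℕ :=
  {p ∈ Finset.Icc 1 (n - 1) | p ∈ I ∧ p - 1 ∉ I}

/-- `Δ^B(I)` in degree `n`. If `0 ∈ I`, then `1` is not in the peak set of `I`. -/
noncomputable def deltaB (n : ℕ) (I : Finset ℕ) : MvPowerSeries ℕ ℤ :=
  if 0 ∈ I then peakFun1 n (peakSetB n I) else peakFun0 n (peakSetB n I)

/-! ### The 2-quotient of a partition -/

/-- `λ^⋆`: with `k` the number of parts, `k - i` is added to the `i`-th part (`i = 1, …, k`). -/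
def starParts (l : List ℕ) : List ℕ :=
  l.mapIdx fun i x => x + (l.length - (i + 1))

/-- Given a strictly decreasing list of numbers of parity `r ∈ {0, 1}`, subtract
`r, r + 2, r + 4, …` from right to left, halve the results, and remove the zeros. -/
def quotientParts (r : ℕ) (l : List ℕ) : List ℕ :=
  (l.mapIdx fun i x => (x - (2 * (l.length - (i + 1)) + r)) / 2).filter (· ≠ 0)

/-- The 2-quotient `(μ, ν)` of the partition with the given list of parts, in weakly decreasing
order; `μ` comes from the even entries of `λ^⋆` and `ν` from the odd ones. -/
def twoQuotient (l : List ℕ) : List ℕ × List ℕ :=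
  (quotientParts 0 ((starParts l).filter (· % 2 = 0)),
    quotientParts 1 ((starParts l).filter (· % 2 = 1)))

/-- The last (smallest) part, if there is one, is at least the number of parts. -/
def LastPartLarge (l : List ℕ) : Prop :=
  ∀ x ∈ l.getLast?, l.length ≤ x

/-- The 2-quotient `((μ_1, …, μ_p), (ν_1, …, ν_q))` of `lam` satisfies `μ_p ≥ p` and
`ν_q ≥ q`. -/
def QuotientCondition (lam : YoungDiagram) : Prop :=
  LastPartLarge (twoQuotient lam.rowLens).1 ∧ LastPartLarge (twoQuotient lam.rowLens).2

/-! ### Dominoes and shifted tilings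

A cell is a pair `(row, column)`, rows being numbered from top to bottom and columns from left to
right, as in `YoungDiagram`. The main diagonal consists of the cells `(i, i)`. -/

/-- A set of cells; the dominoes are those satisfying `IsDomino`. -/
abbrev Cells : Type := Finset (ℕ × ℕ)

def IsHorizontal (d : Cells) : Prop := ∃ i j : ℕ, d = {(i, j), (i, j + 1)}

def IsVertical (d : Cells) : Prop := ∃ i j : ℕ, d = {(i, j), (i + 1, j)}

def IsDomino (d : Cells) : Prop := IsHorizontal d ∨ IsVertical d

/-- `t` is a set of dominoes that tiles the Young diagram `lam`. -/
def IsDominoTiling (lam : YoungDiagram) (t : Finset Cells) : Prop :=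
  (∀ d ∈ t, IsDomino d) ∧ (t : Set Cells).PairwiseDisjoint id ∧ t.biUnion id = lam.cells

/-- The domino meets the main diagonal. -/
def OnDiagonal (d : Cells) : Prop := ∃ c ∈ d, c.1 = c.2

/-- All cells of the domino are strictly below the main diagonal. -/
def StrictlyBelowDiagonal (d : Cells) : Prop := ∀ c ∈ d, c.2 < c.1

/-- The domino is not strictly below the main diagonal: it meets the diagonal or lies above. -/
def WeaklyAboveDiagonal (d : Cells) : Prop := ∃ c ∈ d, c.1 ≤ c.2

/-- `e ≠ d` has a cell immediately to the left of a cell of `d`. -/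
def LeftAdjacent (e d : Cells) : Prop := e ≠ d ∧ ∃ c ∈ e, (c.1, c.2 + 1) ∈ d

/-- Shifted tilings: no vertical domino `d` on the main diagonal has the property that the
dominoes left of `d` and adjacent to `d` (there being at least one) are all strictly below the
main diagonal. A vertical domino covering the two top cells of the first column is allowed. -/
def IsShiftedTiling (lam : YoungDiagram) (t : Finset Cells) : Prop :=
  IsDominoTiling lam t ∧
    ¬ ∃ d ∈ t, IsVertical d ∧ OnDiagonal d ∧ (∃ e ∈ t, LeftAdjacent e d) ∧
      ∀ e ∈ t, LeftAdjacent e d → StrictlyBelowDiagonal e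

open Classical in
/-- The set of dominoes of `t` weakly above the main diagonal. -/
noncomputable def upperDominoes (t : Finset Cells) : Finset Cells :=
  {d ∈ t | WeaklyAboveDiagonal d}

/-- `s` is the set of dominoes weakly above the main diagonal of a shifted tiling of `lam`. -/
def IsUpperPart (lam : YoungDiagram) (s : Finset Cells) : Prop :=
  ∃ t : Finset Cells, IsShiftedTiling lam t ∧ upperDominoes t = s

/-- Some cell of `d` is in the same row as, and to the left of, some cell of `e`. -/
def LeftInRow (d e : Cells) : Prop := ∃ c ∈ d, ∃ c' ∈ e, c.1 = c'.1 ∧ c.2 < c'.2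

/-- Some cell of `d` is in the same column as, and above, some cell of `e`. -/
def AboveInColumn (d e : Cells) : Prop := ∃ c ∈ d, ∃ c' ∈ e, c.2 = c'.2 ∧ c.1 < c'.1

def ShareRow (d e : Cells) : Prop := ∃ c ∈ d, ∃ c' ∈ e, c.1 = c'.1

def ShareColumn (d e : Cells) : Prop := ∃ c ∈ d, ∃ c' ∈ e, c.2 = c'.2

/-- `e` is strictly lower than `d`: each cell of `e` is in a lower row than each cell of `d`. -/
def StrictlyLower (e d : Cells) : Prop := ∀ c ∈ d, ∀ c' ∈ e, c.1 < c'.1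

/-! ### The alphabet `0 < 1' < 1 < 2' < 2 < ⋯` -/

/-- `unprimed k` is the letter `k` (for `k ≥ 0`), and `primed k` is the letter `k'`
(for `k ≥ 1`). -/
inductive Letter : Type
  | unprimed (k : ℕ) : Letter
  | primed (k : ℕ+) : Letter

namespace Letter

/-- The position in the ordered alphabet, starting from `0`. -/
def rank : Letter → ℕ
  | unprimed k => 2 * k
  | primed k => 2 * (k : ℕ) - 1

theorem rank_injective : Function.Injective rank := by
  rintro (a | a) (b | b) h
  · simp only [rank] at h
    exact congrArg _ (by omega)
  · have := b.pos
    simp only [rank] at h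
    omega
  · have := a.pos
    simp only [rank] at h
    omega
  · have := a.pos
    have := b.pos
    simp only [rank] at h
    exact congrArg _ (PNat.coe_injective (by omega))

noncomputable instance : LinearOrder Letter := LinearOrder.lift' rank rank_injective

/-- The letter without its prime. -/
def abs : Letter → ℕ
  | unprimed k => k
  | primed k => k

theorem finite_abs_mem (s : Finset ℕ) : Finite {x : Letter // x.abs ∈ s} := by
  have h : ∀ x : {x : Letter // x.abs ∈ s}, x.1.rank < 2 * s.sup id + 1 := by
    rintro ⟨x, hx⟩
    have := Finset.le_sup (f := id) hx
    cases x <;> simp only [rank, abs, id] at * <;> omega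
  refine Finite.of_injective
    (fun x : {x : Letter // x.abs ∈ s} => (⟨x.1.rank, h x⟩ : Fin (2 * s.sup id + 1))) ?_
  intro x y hxy
  exact Subtype.ext (rank_injective (congrArg Fin.val hxy))

end Letter

/-! ### Semistandard shifted domino tableaux -/

/-- Semistandard shifted domino tableaux of shape `lam`: fillings of the dominoes weakly above
the main diagonal in a shifted tiling of `lam`. -/
structure SSShDT (lam : YoungDiagram) : Type where
  dominoes : Finset Cells
  isUpperPart : IsUpperPart lam dominoes
  entry : {d // d ∈ dominoes} → Letter
  row_weak : ∀ d e : {d // d ∈ dominoes}, LeftInRow d.1 e.1 → entry d ≤ entry e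
  column_weak : ∀ d e : {d // d ∈ dominoes}, AboveInColumn d.1 e.1 → entry d ≤ entry e
  /-- Each row contains at most one `k'`. -/
  row_primed : ∀ (k : ℕ+) (d e : {d // d ∈ dominoes}), ShareRow d.1 e.1 →
    entry d = Letter.primed k → entry e = Letter.primed k → d = e
  /-- Each column contains at most one `k`, including `k = 0`. -/
  column_unprimed : ∀ (k : ℕ) (d e : {d // d ∈ dominoes}), ShareColumn d.1 e.1 →
    entry d = Letter.unprimed k → entry e = Letter.unprimed k → d = e
  /-- The northwest-most domino may be filled with `0` only if it is horizontal. -/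
  northwest_zero : ∀ d : {d // d ∈ dominoes}, (0, 0) ∈ d.1 →
    entry d = Letter.unprimed 0 → IsHorizontal d.1

/-- The weight: `wt_k` is the number of entries equal to `k` or `k'`. -/
noncomputable def SSShDT.wt {lam : YoungDiagram} (T : SSShDT lam) : ℕ →₀ ℕ :=
  ∑ d : {d // d ∈ T.dominoes}, Finsupp.single (T.entry d).abs 1

theorem IsUpperPart.mem_powerset {lam : YoungDiagram} {s : Finset Cells}
    (h : IsUpperPart lam s) : s ∈ lam.cells.powerset.powerset := by
  classical
  obtain ⟨t, ht, rfl⟩ := h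
  rw [Finset.mem_powerset]
  intro d hd
  rw [Finset.mem_powerset, ← ht.1.2.2]
  exact Finset.subset_biUnion_of_mem id (Finset.mem_of_mem_filter d hd)

theorem SSShDT.finite_wt_eq (lam : YoungDiagram) (e : ℕ →₀ ℕ) :
    Finite {T : SSShDT lam // T.wt = e} := by
  have key : ∀ T : {T : SSShDT lam // T.wt = e}, ∀ d : {d // d ∈ T.1.dominoes},
      (T.1.entry d).abs ∈ e.support := by
    rintro ⟨T, rfl⟩ d
    unfold SSShDT.wt
    rw [Finsupp.mem_support_iff, Finsupp.finsetSum_apply]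
    refine ne_of_gt (Finset.sum_pos' (fun _ _ => Nat.zero_le _) ⟨d, Finset.mem_univ _, ?_⟩)
    simp
  have := Letter.finite_abs_mem e.support
  refine Finite.of_injective
    (fun T : {T : SSShDT lam // T.wt = e} =>
      (⟨⟨T.1.dominoes, T.1.isUpperPart.mem_powerset⟩,
        fun d => ⟨T.1.entry d, key T d⟩⟩ :
        (s : {s // s ∈ lam.cells.powerset.powerset}) ×
          ({d // d ∈ s.1} → {x : Letter // x.abs ∈ e.support}))) ?_
  rintro ⟨⟨s, hs, f, h1, h2, h3, h4, h5⟩, hT⟩ ⟨⟨s', hs', f', h1', h2', h3', h4', h5'⟩, hT'⟩ h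
  simp only [Sigma.mk.injEq, Subtype.mk.injEq] at h
  obtain ⟨rfl, h⟩ := h
  have hf : f = f' := by
    funext d
    exact congrArg Subtype.val (congrFun (eq_of_heq h) d)
  subst hf
  rfl

/-- The shifted domino function `H_lam = ∑_T x^{wt T}`. -/
noncomputable def shiftedDominoFun (lam : YoungDiagram) : MvPowerSeries ℕ ℤ :=
  genFun (SSShDT.wt : SSShDT lam → (ℕ →₀ ℕ))

/-! ### Standard shifted domino tableaux -/

/-- Standard shifted domino tableaux of shape `lam`: bijective fillings of the `m` dominoes
weakly above the main diagonal in a shifted tiling of `lam` with the numbers `1, …, m`. -/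
structure SShDT (lam : YoungDiagram) : Type where
  dominoes : Finset Cells
  isUpperPart : IsUpperPart lam dominoes
  entry : {d // d ∈ dominoes} → ℕ
  injective : Function.Injective entry
  range_eq : Set.range entry = Set.Icc 1 dominoes.card
  row_strict : ∀ d e : {d // d ∈ dominoes}, d ≠ e → LeftInRow d.1 e.1 → entry d < entry e
  column_strict : ∀ d e : {d // d ∈ dominoes}, d ≠ e → AboveInColumn d.1 e.1 → entry d < entry e

namespace SShDT

variable {lam : YoungDiagram}

/-- The number `m` of dominoes weakly above the main diagonal. -/
def size (Q : SShDT lam) : ℕ := Q.dominoes.card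

/-- `i ∈ [0, m-1]` is a descent if `i = 0` and the domino with entry `1` is vertical, or if
`i > 0` and the domino with entry `i + 1` is strictly lower than the domino with entry `i`. -/
def IsDescent (Q : SShDT lam) (i : ℕ) : Prop :=
  (i = 0 ∧ ∃ d, Q.entry d = 1 ∧ IsVertical d.1) ∨
    (0 < i ∧ ∃ d e, Q.entry d = i ∧ Q.entry e = i + 1 ∧ StrictlyLower e.1 d.1)

open Classical in
/-- The descent set. -/
noncomputable def des (Q : SShDT lam) : Finset ℕ :=
  {i ∈ Finset.range Q.size | Q.IsDescent i}

instance finite (lam : YoungDiagram) : Finite (SShDT lam) := by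
  have key : ∀ Q : SShDT lam, ∀ d : {d // d ∈ Q.dominoes},
      Q.entry d < Q.dominoes.card + 1 := by
    intro Q d
    have h : Q.entry d ∈ Set.Icc 1 Q.dominoes.card := by
      rw [← Q.range_eq]
      exact Set.mem_range_self d
    exact Nat.lt_succ_of_le h.2
  refine Finite.of_injective
    (fun Q : SShDT lam =>
      (⟨⟨Q.dominoes, Q.isUpperPart.mem_powerset⟩, fun d => ⟨Q.entry d, key Q d⟩⟩ :
        (s : {s // s ∈ lam.cells.powerset.powerset}) ×
          ({d // d ∈ s.1} → Fin (s.1.card + 1)))) ?_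
  rintro ⟨s, hs, f, h1, h2, h3, h4⟩ ⟨s', hs', f', h1', h2', h3', h4'⟩ h
  simp only [Sigma.mk.injEq, Subtype.mk.injEq] at h
  obtain ⟨rfl, h⟩ := h
  have hf : f = f' := by
    funext d
    exact congrArg Fin.val (congrFun (eq_of_heq h) d)
  subst hf
  rfl

noncomputable instance fintype (lam : YoungDiagram) : Fintype (SShDT lam) := Fintype.ofFinite _

end SShDT

end ShiftedDomino

namespace ShiftedDomino

/-! ### Counting lemmas for finite sets -/

/-! The proof is a standardization argument in the style of enriched P-partitions, made coefficient
by coefficient. The intermediate object is `EnrichedSeq`: a weakly increasing word starting with the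
letter 0, in which neighbours may both equal `k` only at a non-descent and both equal `k'` only at a
descent.

First, the peak function of `I` enumerates these words (`coeff_deltaB`). Fix the absolute values,
and let `S` be their set of strict steps. The admissible sets of primed positions form a Boolean
interval, which is empty or has `2 ^ S.card` elements (`card_primedSets`). On the other side,
exchanging the sums in `deltaB` leaves, for each weakly increasing sequence, a power of 2 times the
number of peak-compatible `J ⊆ S`; toggling one element per peak shows that this is the same number
(`card_compatible_zero`, `card_compatible_one`).

Second, semistandard tableaux correspond to standard ones equipped with an enriched word for the
descent set (`standardizationEquiv`). Relabelling entry `i` by the `i`-th letter is inverted by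
sorting: equal unprimed letters from left to right, equal primed ones from top to bottom. The
geometric core is that a non-descent forces the next domino strictly to the right
(`SShDT.strictlyRight_of_not_mem_des`) and, conversely, that equal unprimed letters never descend
(`SSShDT.not_strictlyLower_of_unprimed`). Both use that the upper part of a tiling covers every cell
weakly above the diagonal that lies northwest of one of its cells (`IsUpperPart.exists_mem`). The
initial letter 0 of the word encodes the rule for the northwest-most domino. -/

theorem two_mul_card_filter_of_toggle {F : Finset (Finset ℕ)} {p : Finset ℕ → Prop}
    [DecidablePred p] (r : ℕ) (hF : ∀ J ∈ F, symmDiff J {r} ∈ F)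
    (hp : ∀ J ∈ F, (p (symmDiff J {r}) ↔ ¬ p J)) :
    2 * (F.filter p).card = F.card := by
  have h : (F.filter p).card = (F.filter fun J => ¬ p J).card := by
    refine Finset.card_bij' (fun J _ => symmDiff J {r}) (fun J _ => symmDiff J {r}) ?_ ?_ ?_ ?_
    · intro J hJ
      rw [Finset.mem_filter] at hJ ⊢
      exact ⟨hF J hJ.1, fun h => (hp J hJ.1).1 h hJ.2⟩
    · intro J hJ
      rw [Finset.mem_filter] at hJ ⊢
      exact ⟨hF J hJ.1, (hp J hJ.1).2 hJ.2⟩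
    · intro J _
      exact symmDiff_symmDiff_cancel_right _ _
    · intro J _
      exact symmDiff_symmDiff_cancel_right _ _
  have := Finset.card_filter_add_card_filter_not (s := F) p
  omega

/-- `PeakCompatible` for sets of positive numbers. -/
theorem peakCompatible_iff {P J : Finset ℕ} (hP : ∀ p ∈ P, 1 ≤ p) :
    PeakCompatible P J ↔ ∀ p ∈ P, (p ∈ J ↔ p - 1 ∉ J) := by
  unfold PeakCompatible
  refine forall₂_congr fun p hp => ?_
  have h1 := hP p hp
  have : (p ∈ J.image (· + 1)) ↔ p - 1 ∈ J := by
    rw [Finset.mem_image]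
    constructor
    · rintro ⟨a, ha, rfl⟩
      simpa using ha
    · intro h
      exact ⟨p - 1, h, by omega⟩
  rw [Finset.mem_symmDiff, this]
  tauto

theorem mem_symmDiff_singleton {J : Finset ℕ} {r x : ℕ} :
    x ∈ symmDiff J {r} ↔ if x = r then x ∉ J else x ∈ J := by
  rw [Finset.mem_symmDiff, Finset.mem_singleton]
  split_ifs with h <;> simp [h]

theorem symmDiff_singleton_subset {J S : Finset ℕ} {r : ℕ} (hJ : J ⊆ S) (hr : r ∈ S) :
    symmDiff J {r} ⊆ S := by
  intro x hx
  rw [mem_symmDiff_singleton] at hx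
  split_ifs at hx with h
  · exact h ▸ hr
  · exact hJ hx

/-- For `P` without consecutive elements, the condition `p ∈ J ↔ p - 1 ∉ J` halves the number of
subsets of `S` for each `p ∈ P` such that `p` or `p - 1` belongs to `S`. -/
theorem two_pow_mul_card_compatible (S : Finset ℕ) (P : Finset ℕ) (hP : ∀ p ∈ P, 1 ≤ p)
    (hP' : ∀ p ∈ P, p + 1 ∉ P) (hS : ∀ p ∈ P, p ∈ S ∨ p - 1 ∈ S) :
    2 ^ P.card * (S.powerset.filter fun J => ∀ p ∈ P, (p ∈ J ↔ p - 1 ∉ J)).card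
      = 2 ^ S.card := by
  classical
  induction P using Finset.induction_on with
  | empty => simp
  | insert q P hq ih =>
    have ih' := ih (fun p hp => hP p (Finset.mem_insert_of_mem hp))
      (fun p hp h => hP' p (Finset.mem_insert_of_mem hp) (Finset.mem_insert_of_mem h))
      (fun p hp => hS p (Finset.mem_insert_of_mem hp))
    rw [← ih', Finset.card_insert_of_notMem hq, pow_succ, mul_assoc]
    congr 1
    have hq1 := hP q (Finset.mem_insert_self q P)
    -- Toggling `r` flips the condition at `q`. As `q - 1` and `q + 1` are not in `P`, no other
    -- condition involves `r`.
    obtain ⟨r, hr, hrq⟩ : ∃ r ∈ S, r = q ∨ r = q - 1 := by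
      rcases hS q (Finset.mem_insert_self q P) with h | h
      · exact ⟨q, h, Or.inl rfl⟩
      · exact ⟨q - 1, h, Or.inr rfl⟩
    have hfar : ∀ p ∈ P, p ≠ r ∧ p - 1 ≠ r := by
      intro p hp
      have h1 := hP p (Finset.mem_insert_of_mem hp)
      have h2 : p ≠ q := fun h => hq (h ▸ hp)
      have h3 : p + 1 ≠ q := fun h =>
        hP' p (Finset.mem_insert_of_mem hp) (h ▸ Finset.mem_insert_self q P)
      have h4 : q + 1 ≠ p := fun h =>
        hP' q (Finset.mem_insert_self q P) (h ▸ Finset.mem_insert_of_mem hp)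
      omega
    rw [← two_mul_card_filter_of_toggle
      (F := S.powerset.filter fun J => ∀ p ∈ P, (p ∈ J ↔ p - 1 ∉ J))
      (p := fun J => q ∈ J ↔ q - 1 ∉ J) r]
    · congr 2
      ext J
      simp only [Finset.mem_filter, Finset.forall_mem_insert]
      tauto
    · intro J hJ
      rw [Finset.mem_filter, Finset.mem_powerset] at hJ ⊢
      refine ⟨symmDiff_singleton_subset hJ.1 hr, fun p hp => ?_⟩
      rw [mem_symmDiff_singleton, mem_symmDiff_singleton, if_neg (hfar p hp).1,
        if_neg (hfar p hp).2]
      exact hJ.2 p hp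
    · intro J _
      have h1 : q ≠ q - 1 := by omega
      rw [mem_symmDiff_singleton, mem_symmDiff_singleton]
      rcases hrq with rfl | rfl
      · rw [if_pos rfl, if_neg h1.symm]
        tauto
      · rw [if_pos rfl, if_neg h1]
        tauto

/-- The condition on a set `S ⊆ [0, n-1]` of strict steps under which a weakly increasing sequence
is the sequence of absolute values of some enriched sequence with descent set `I`. -/
def PeakGood (n : ℕ) (I S : Finset ℕ) : Prop :=
  (0 ∈ I → 0 ∈ S) ∧ ∀ p ∈ peakSetB n I, p ∈ S ∨ p - 1 ∈ S

theorem mem_peakSetB {n p : ℕ} {I : Finset ℕ} :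
    p ∈ peakSetB n I ↔ (1 ≤ p ∧ p ≤ n - 1) ∧ p ∈ I ∧ p - 1 ∉ I := by
  simp [peakSetB]

-- Two peaks are never consecutive, so each peak halves the number of subsets. A peak `p` with
-- neither `p` nor `p - 1` in `S` leaves no compatible subset at all.
open Classical in
theorem card_compatible_zero {n : ℕ} {I S : Finset ℕ} (h0 : 0 ∉ I) :
    2 ^ (peakSetB n I).card *
        (S.powerset.filter fun J => PeakCompatible (peakSetB n I) J).card
      = if PeakGood n I S then 2 ^ S.card else 0 := by
  have hP : ∀ p ∈ peakSetB n I, 1 ≤ p := fun p hp => (mem_peakSetB.1 hp).1.1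
  have hP' : ∀ p ∈ peakSetB n I, p + 1 ∉ peakSetB n I := fun p hp h =>
    (mem_peakSetB.1 h).2.2 (by simpa using (mem_peakSetB.1 hp).2.1)
  simp only [peakCompatible_iff hP]
  split_ifs with h
  · convert two_pow_mul_card_compatible S _ hP hP' h.2
  · rw [mul_eq_zero]
    right
    rw [Finset.card_eq_zero, Finset.filter_eq_empty_iff]
    intro J hJ hc
    rw [Finset.mem_powerset] at hJ
    refine h ⟨fun h => absurd h h0, fun p hp => ?_⟩
    by_cases hpJ : p ∈ J
    · exact Or.inl (hJ hpJ)
    · right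
      have := hc p hp
      exact hJ (by tauto)

-- The requirement `0 ∈ J` costs one more factor 2, which the exponent compensates. It is
-- independent of the peak conditions: since `0 ∈ I`, the number 1 is not a peak, so toggling 0
-- affects none of them.
open Classical in
theorem card_compatible_one {n : ℕ} {I S : Finset ℕ} (h0 : 0 ∈ I) :
    2 ^ ((peakSetB n I).card + 1) *
        (S.powerset.filter fun J => 0 ∈ J ∧ PeakCompatible (peakSetB n I) J).card
      = if PeakGood n I S then 2 ^ S.card else 0 := by
  have hP : ∀ p ∈ peakSetB n I, 1 ≤ p := fun p hp => (mem_peakSetB.1 hp).1.1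
  have hP' : ∀ p ∈ peakSetB n I, p + 1 ∉ peakSetB n I := fun p hp h =>
    (mem_peakSetB.1 h).2.2 (by simpa using (mem_peakSetB.1 hp).2.1)
  simp only [peakCompatible_iff hP]
  split_ifs with h
  · rw [← two_pow_mul_card_compatible S _ hP hP' h.2, pow_succ, mul_assoc]
    congr 1
    rw [← two_mul_card_filter_of_toggle
      (F := S.powerset.filter fun J => ∀ p ∈ peakSetB n I, (p ∈ J ↔ p - 1 ∉ J))
      (p := fun J => 0 ∈ J) 0]
    · congr 2
      ext J
      simp only [Finset.mem_filter]
      tauto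
    · intro J hJ
      rw [Finset.mem_filter, Finset.mem_powerset] at hJ ⊢
      refine ⟨symmDiff_singleton_subset hJ.1 (h.1 h0), fun p hp => ?_⟩
      have h1 : p ≠ 0 := by have := hP p hp; omega
      have h2 : p - 1 ≠ 0 := by
        intro h
        exact (mem_peakSetB.1 hp).2.2 (h ▸ h0)
      rw [mem_symmDiff_singleton, mem_symmDiff_singleton, if_neg h1, if_neg h2]
      exact hJ.2 p hp
    · intro J _
      rw [mem_symmDiff_singleton, if_pos rfl]
  · rw [mul_eq_zero]
    right
    rw [Finset.card_eq_zero, Finset.filter_eq_empty_iff]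
    rintro J hJ ⟨hz, hc⟩
    rw [Finset.mem_powerset] at hJ
    refine h ⟨fun _ => hJ hz, fun p hp => ?_⟩
    by_cases hpJ : p ∈ J
    · exact Or.inl (hJ hpJ)
    · right
      have := hc p hp
      exact hJ (by tauto)

/-- The possible sets `U ⊆ [1, n]` of primed positions in an enriched sequence whose set of strict
steps is `S`. -/
def primedSets (n : ℕ) (I S : Finset ℕ) : Finset (Finset ℕ) :=
  {U ∈ (Finset.Icc 1 n).powerset |
    ∀ q ∈ Finset.range n, q ∉ S → (q ∈ I → q ∈ U) ∧ (q ∉ I → q + 1 ∉ U)}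

-- Each weak step `q` imposes one constraint: a prime at `q` if `q ∈ I`, no prime at `q + 1`
-- otherwise. Hence the solutions form an interval of sets between the forced positions `A` and the
-- complement of the forbidden ones `C`. Its dimension is `n` minus the number of weak steps, which
-- is `S.card`. It is nonempty unless 0 is forced or some position is both forced and forbidden; the
-- latter happens exactly at a peak `p` with `p` and `p - 1` outside `S`.
open Classical in
theorem card_primedSets {n : ℕ} {I S : Finset ℕ} (hI : I ⊆ Finset.range n)
    (hS : S ⊆ Finset.range n) :
    (primedSets n I S).card = if PeakGood n I S then 2 ^ S.card else 0 := by
  set N := Finset.range n \ S with hN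
  set A := N.filter (· ∈ I) with hA
  set C := (N.filter (· ∉ I)).image (· + 1) with hC
  have hCsub : C ⊆ Finset.Icc 1 n := by
    intro x hx
    simp only [hC, hN, Finset.mem_image, Finset.mem_filter, Finset.mem_sdiff,
      Finset.mem_range] at hx
    obtain ⟨y, hy, rfl⟩ := hx
    rw [Finset.mem_Icc]
    omega
  have hIcc : primedSets n I S = Finset.Icc A (Finset.Icc 1 n \ C) := by
    ext U
    simp only [primedSets, Finset.mem_filter, Finset.mem_powerset, Finset.mem_Icc,
      Finset.subset_sdiff, Finset.disjoint_left]
    constructor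
    · rintro ⟨hU, h⟩
      refine ⟨fun q hq => ?_, hU, fun x hx hxC => ?_⟩
      · simp only [hA, hN, Finset.mem_filter, Finset.mem_sdiff] at hq
        exact (h q hq.1.1 hq.1.2).1 hq.2
      · simp only [hC, hN, Finset.mem_image, Finset.mem_filter, Finset.mem_sdiff] at hxC
        obtain ⟨y, hy, rfl⟩ := hxC
        exact (h y hy.1.1 hy.1.2).2 hy.2 hx
    · rintro ⟨hAU, hU, h⟩
      refine ⟨hU, fun q hq hqS => ⟨fun hqI => hAU ?_, fun hqI hqU => h hqU ?_⟩⟩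
      · simp only [hA, hN, Finset.mem_filter, Finset.mem_sdiff]
        exact ⟨⟨hq, hqS⟩, hqI⟩
      · simp only [hC, hN, Finset.mem_image, Finset.mem_filter, Finset.mem_sdiff]
        exact ⟨q, ⟨⟨hq, hqS⟩, hqI⟩, rfl⟩
  have hgood : PeakGood n I S ↔ A ⊆ Finset.Icc 1 n \ C := by
    constructor
    · rintro ⟨h0, hp⟩ q hq
      simp only [hA, hN, Finset.mem_filter, Finset.mem_sdiff, Finset.mem_range] at hq
      have hq0 : q ≠ 0 := by
        rintro rfl
        exact hq.1.2 (h0 hq.2)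
      rw [Finset.mem_sdiff, Finset.mem_Icc]
      refine ⟨by omega, fun hqC => ?_⟩
      simp only [hC, hN, Finset.mem_image, Finset.mem_filter, Finset.mem_sdiff] at hqC
      obtain ⟨y, hy, rfl⟩ := hqC
      rcases hp (y + 1) (mem_peakSetB.2 ⟨by omega, hq.2, hy.2⟩) with h | h
      · exact hq.1.2 h
      · exact hy.1.2 h
    · intro h
      refine ⟨fun h0 => ?_, fun p hp => ?_⟩
      · by_contra h0S
        have := h (show 0 ∈ A by
          simp only [hA, hN, Finset.mem_filter, Finset.mem_sdiff]
          exact ⟨⟨hI h0, h0S⟩, h0⟩)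
        simp at this
      · by_contra! hpS
        rw [mem_peakSetB] at hp
        have := h (show p ∈ A by
          simp only [hA, hN, Finset.mem_filter, Finset.mem_sdiff]
          exact ⟨⟨hI hp.2.1, hpS.1⟩, hp.2.1⟩)
        refine (Finset.mem_sdiff.1 this).2 ?_
        simp only [hC, hN, Finset.mem_image, Finset.mem_filter, Finset.mem_sdiff,
          Finset.mem_range]
        exact ⟨p - 1, ⟨⟨by omega, hpS.2⟩, hp.2.2⟩, by omega⟩
  rw [hIcc]
  split_ifs with h
  · rw [Finset.card_Icc_finset (hgood.1 h), Finset.card_sdiff_of_subset hCsub, Nat.card_Icc]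
    have hCc : C.card = (N.filter (· ∉ I)).card :=
      Finset.card_image_of_injective _ (add_left_injective 1)
    have hNc : N.card + S.card = n := by
      rw [hN, Finset.card_sdiff_add_card_eq_card hS, Finset.card_range]
    have hAc : A.card + (N.filter (· ∉ I)).card = N.card := by
      rw [hA]
      convert Finset.card_filter_add_card_filter_not (s := N) (· ∈ I)
    congr 1
    omega
  · rw [Finset.card_eq_zero, Finset.Icc_eq_empty_iff]
    exact fun hle => h (hgood.2 hle)

/-! ### Letters -/

namespace Letter

theorem le_iff_rank {a b : Letter} : a ≤ b ↔ a.rank ≤ b.rank := Iff.rfl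

/-- Whether the letter carries a prime. -/
def isPrimed : Letter → Bool
  | unprimed _ => false
  | primed _ => true

/-- The letter with absolute value `k` that is primed if `b` holds and `k` is positive. -/
def ofAbs (k : ℕ) (b : Bool) : Letter :=
  if h : b = true ∧ 0 < k then primed ⟨k, h.2⟩ else unprimed k

theorem abs_ofAbs (k : ℕ) (b : Bool) : (ofAbs k b).abs = k := by
  unfold ofAbs
  split_ifs <;> rfl

theorem isPrimed_ofAbs {k : ℕ} {b : Bool} (h : b = true → 0 < k) : (ofAbs k b).isPrimed = b := by
  unfold ofAbs
  split_ifs with h'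
  · exact h'.1.symm
  · cases b
    · rfl
    · exact absurd ⟨rfl, h rfl⟩ h'

theorem eq_of_abs_of_isPrimed {a b : Letter} (h : a.abs = b.abs) (h' : a.isPrimed = b.isPrimed) :
    a = b := by
  rcases a with a | a <;> rcases b with b | b
  · exact congrArg unprimed h
  · cases h'
  · cases h'
  · exact congrArg primed (PNat.coe_injective h)

/-- Among letters of absolute value `k`, the ordered pairs are `k'k'`, `k'k` and `kk`. A descent
excludes `kk`, so the first letter is primed; a non-descent excludes `k'k'`, so the second is
unprimed. This separates the choice of absolute values from the choice of primes. -/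
theorem step_iff {x y : Letter} {D : Prop} :
    (x ≤ y ∧ (∀ k, x = unprimed k → y = unprimed k → ¬ D) ∧
        ∀ k, x = primed k → y = primed k → D) ↔
      x.abs ≤ y.abs ∧
        (x.abs = y.abs → (D → x.isPrimed = true) ∧ (¬ D → y.isPrimed ≠ true)) := by
  rw [le_iff_rank]
  rcases x with a | a <;> rcases y with b | b
  · simp only [rank, abs, isPrimed, unprimed.injEq, reduceCtorEq]
    grind
  · have := b.pos
    simp only [rank, abs, isPrimed, reduceCtorEq]
    grind
  · have := a.pos
    simp only [rank, abs, isPrimed, reduceCtorEq]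
    grind
  · have := a.pos
    have := b.pos
    have h : a = b ↔ (a : ℕ) = b := PNat.coe_inj.symm
    simp only [rank, abs, isPrimed, primed.injEq, reduceCtorEq]
    grind

end Letter

/-! ### Enriched sequences -/

/-- Sequences of letters `0 = a_0 ≤ a_1 ≤ ⋯ ≤ a_n` in which equal consecutive entries
`a_j = a_{j+1}` are unprimed only if `j ∉ I` and primed only if `j ∈ I`. -/
def EnrichedSeq (n : ℕ) (I : Finset ℕ) : Type :=
  {a : Fin (n + 1) → Letter // a 0 = Letter.unprimed 0 ∧ ∀ j : Fin n,
    a j.castSucc ≤ a j.succ ∧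
    (∀ k, a j.castSucc = Letter.unprimed k → a j.succ = Letter.unprimed k → ¬ (j : ℕ) ∈ I) ∧
    ∀ k, a j.castSucc = Letter.primed k → a j.succ = Letter.primed k → (j : ℕ) ∈ I}

namespace EnrichedSeq

variable {n : ℕ} {I : Finset ℕ}

theorem monotone (a : EnrichedSeq n I) : Monotone a.1 :=
  Fin.monotone_iff_le_succ.2 fun j => (a.2.2 j).1

/-- The exponent of the monomial `x_{|a_1|} ⋯ x_{|a_n|}`. -/
noncomputable def wt (a : EnrichedSeq n I) : ℕ →₀ ℕ :=
  ∑ j : Fin n, Finsupp.single (a.1 j.succ).abs 1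

end EnrichedSeq

/-- The positions of the strict steps of a sequence. -/
def strictSteps {n : ℕ} (i : Fin (n + 1) → ℕ) : Finset ℕ :=
  (Finset.univ.filter fun j : Fin n => i j.castSucc < i j.succ).image Fin.val

theorem mem_strictSteps {n : ℕ} {i : Fin (n + 1) → ℕ} {j : Fin n} :
    (j : ℕ) ∈ strictSteps i ↔ i j.castSucc < i j.succ := by
  unfold strictSteps
  rw [Finset.mem_image]
  constructor
  · rintro ⟨k, hk, h⟩
    rw [← Fin.ext h]
    exact (Finset.mem_filter.1 hk).2
  · intro h
    exact ⟨j, by simpa using h, rfl⟩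

theorem strictSteps_subset {n : ℕ} (i : Fin (n + 1) → ℕ) : strictSteps i ⊆ Finset.range n := by
  intro x hx
  unfold strictSteps at hx
  obtain ⟨k, _, rfl⟩ := Finset.mem_image.1 hx
  exact Finset.mem_range.2 k.2

theorem subset_strictSteps_iff {n : ℕ} {i : Fin (n + 1) → ℕ} {J : Finset ℕ}
    (hJ : J ⊆ Finset.range n) :
    J ⊆ strictSteps i ↔ ∀ j : Fin n, (j : ℕ) ∈ J → i j.castSucc < i j.succ := by
  constructor
  · exact fun h j hj => mem_strictSteps.1 (h hj)
  · intro h x hx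
    have hxn := Finset.mem_range.1 (hJ hx)
    exact mem_strictSteps (j := ⟨x, hxn⟩).2 (h ⟨x, hxn⟩ hx)

/-- Positions of primes in a sequence of letters. -/
def primedPositions {n : ℕ} (a : Fin (n + 1) → Letter) : Finset ℕ :=
  (Finset.univ.filter fun j => (a j).isPrimed = true).image Fin.val

theorem mem_primedPositions {n : ℕ} {a : Fin (n + 1) → Letter} {j : Fin (n + 1)} :
    (j : ℕ) ∈ primedPositions a ↔ (a j).isPrimed = true := by
  unfold primedPositions
  rw [Finset.mem_image]
  constructor
  · rintro ⟨k, hk, h⟩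
    rw [← Fin.ext h]
    exact (Finset.mem_filter.1 hk).2
  · intro h
    exact ⟨j, by simpa using h, rfl⟩

/-- The letter 0 has no primed version, so this is needed to realize `U`. Across a weak step a prime
propagates to the preceding position; as position 0 is never primed, a strict step must occur on the
way. -/
theorem pos_of_mem_primedSets {n : ℕ} {I U : Finset ℕ} {i : Fin (n + 1) → ℕ} (hi : Monotone i)
    (hU : U ∈ primedSets n I (strictSteps i)) : ∀ j : Fin (n + 1), (j : ℕ) ∈ U → 0 < i j := by
  unfold primedSets at hU
  rw [Finset.mem_filter, Finset.mem_powerset] at hU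
  intro j
  induction j using Fin.induction with
  | zero =>
    intro h
    have := Finset.mem_Icc.1 (hU.1 h)
    simp at this
  | succ j ih =>
    intro hj
    by_cases hs : (j : ℕ) ∈ strictSteps i
    · exact (Nat.zero_le _).trans_lt (mem_strictSteps.1 hs)
    · have := hU.2 j (Finset.mem_range.2 j.2) hs
      rw [Fin.val_succ] at hj
      have hI : (j : ℕ) ∈ I := by
        by_contra h
        exact this.2 h hj
      exact (ih (this.1 hI)).trans_le (hi (Fin.castSucc_le_succ j))

theorem primedPositions_mem_primedSets {n : ℕ} {I : Finset ℕ} (a : EnrichedSeq n I) :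
    primedPositions a.1 ∈ primedSets n I (strictSteps fun j => (a.1 j).abs) := by
  unfold primedSets
  rw [Finset.mem_filter, Finset.mem_powerset]
  constructor
  · intro x hx
    unfold primedPositions at hx
    obtain ⟨k, hk, rfl⟩ := Finset.mem_image.1 hx
    have hk0 : k ≠ 0 := by
      rintro rfl
      rw [Finset.mem_filter, a.2.1] at hk
      simp [Letter.isPrimed] at hk
    rw [Finset.mem_Icc]
    have := k.2
    have := Fin.pos_iff_ne_zero.2 hk0
    rw [Fin.lt_def] at this
    simp only [Fin.val_zero] at this
    omega
  · intro q hq hqS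
    have hqn := Finset.mem_range.1 hq
    have h := Letter.step_iff.1 (a.2.2 ⟨q, hqn⟩)
    have hS : ¬ _ := fun h => hqS (mem_strictSteps (j := (⟨q, hqn⟩ : Fin n)).2 h)
    have h' := h.2 (le_antisymm h.1 (not_lt.1 hS))
    constructor
    · intro hI
      exact mem_primedPositions (j := (⟨q, hqn⟩ : Fin n).castSucc).2 (h'.1 hI)
    · intro hI hm
      exact h'.2 hI (mem_primedPositions (j := (⟨q, hqn⟩ : Fin n).succ).1 hm)

open Classical in
/-- The enriched sequence with given absolute values and set of primed positions. -/
noncomputable def EnrichedSeq.ofPrimedSet {n : ℕ} {I : Finset ℕ} (i : Fin (n + 1) → ℕ)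
    (h0 : i 0 = 0) (hi : Monotone i) (U : Finset ℕ)
    (hU : U ∈ primedSets n I (strictSteps i)) : EnrichedSeq n I :=
  ⟨fun j => Letter.ofAbs (i j) (decide ((j : ℕ) ∈ U)), by
    have hp := pos_of_mem_primedSets hi hU
    have hpr : ∀ j : Fin (n + 1),
        (Letter.ofAbs (i j) (decide ((j : ℕ) ∈ U))).isPrimed = decide ((j : ℕ) ∈ U) :=
      fun j => Letter.isPrimed_ofAbs fun h => hp j (of_decide_eq_true h)
    refine ⟨?_, fun j => ?_⟩
    · show Letter.ofAbs (i 0) _ = _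
      rw [h0]
      simp [Letter.ofAbs]
    · rw [Letter.step_iff, hpr, hpr, Letter.abs_ofAbs, Letter.abs_ofAbs]
      refine ⟨hi (Fin.castSucc_le_succ j), fun heq => ?_⟩
      unfold primedSets at hU
      have := (Finset.mem_filter.1 hU).2 j (Finset.mem_range.2 j.2)
        (fun h => (mem_strictSteps.1 h).ne heq)
      simpa using this⟩

/-- An enriched sequence is determined by its absolute values and its set of primed positions. -/
noncomputable def enrichedSeqEquiv (n : ℕ) (I : Finset ℕ) (e : ℕ →₀ ℕ) :
    {a : EnrichedSeq n I // a.wt = e} ≃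
      Σ x : {i : FundSeq n ∅ // i.wt = e}, {U // U ∈ primedSets n I (strictSteps x.1.1)} where
  toFun a := ⟨⟨⟨fun j => (a.1.1 j).abs, congrArg Letter.abs a.1.2.1,
      Fin.monotone_iff_le_succ.2 fun j => (Letter.step_iff.1 (a.1.2.2 j)).1, by simp⟩, a.2⟩,
    ⟨primedPositions a.1.1, primedPositions_mem_primedSets a.1⟩⟩
  invFun x := ⟨EnrichedSeq.ofPrimedSet x.1.1.1 x.1.1.2.1 x.1.1.2.2.1 x.2.1 x.2.2, by
    refine Eq.trans ?_ x.1.2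
    unfold EnrichedSeq.wt FundSeq.wt EnrichedSeq.ofPrimedSet
    simp only [Letter.abs_ofAbs]⟩
  left_inv a := by
    apply Subtype.ext
    apply Subtype.ext
    funext j
    have h : (a.1.1 j).isPrimed = true → 0 < (a.1.1 j).abs := by
      cases a.1.1 j with
      | unprimed k => exact fun h => by cases h
      | primed k => exact fun _ => k.pos
    apply Letter.eq_of_abs_of_isPrimed
    · exact Letter.abs_ofAbs _ _
    · refine (Letter.isPrimed_ofAbs fun h' => h ?_).trans ?_
      · exact mem_primedPositions.1 (of_decide_eq_true h')
      · simp [mem_primedPositions]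
  right_inv x := by
    obtain ⟨⟨⟨i, h0, hi, h'⟩, he⟩, U, hU⟩ := x
    have h1 : (fun j => ((EnrichedSeq.ofPrimedSet i h0 hi U hU).1 j).abs) = i :=
      funext fun j => Letter.abs_ofAbs _ _
    have h2 : primedPositions (EnrichedSeq.ofPrimedSet i h0 hi U hU).1 = U := by
      have key : ∀ j : Fin (n + 1),
          (j : ℕ) ∈ primedPositions (EnrichedSeq.ofPrimedSet i h0 hi U hU).1 ↔ (j : ℕ) ∈ U := by
        intro j
        rw [mem_primedPositions]
        unfold EnrichedSeq.ofPrimedSet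
        rw [Letter.isPrimed_ofAbs fun h => pos_of_mem_primedSets hi hU j (of_decide_eq_true h)]
        simp
      ext q
      constructor
      · intro h
        obtain ⟨k, _, rfl⟩ := Finset.mem_image.1 h
        exact (key k).1 h
      · intro h
        have hq : q ≤ n := by
          unfold primedSets at hU
          exact (Finset.mem_Icc.1 (Finset.mem_powerset.1 (Finset.mem_filter.1 hU).1 h)).2
        exact (key ⟨q, Nat.lt_succ_of_le hq⟩).2 h
    have h3 : (⟨⟨fun j => ((EnrichedSeq.ofPrimedSet i h0 hi U hU).1 j).abs, by rw [h1]; exact h0,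
        by rw [h1]; exact hi, by simp⟩, by
          rw [← he]; exact congrArg (fun f : Fin (n + 1) → ℕ =>
            ∑ j : Fin n, Finsupp.single (f j.succ) 1) h1⟩ : {i : FundSeq n ∅ // i.wt = e}) =
        ⟨⟨i, h0, hi, h'⟩, he⟩ := Subtype.ext (Subtype.ext h1)
    refine Sigma.ext h3 ?_
    refine (Subtype.heq_iff_coe_eq ?_).2 h2
    intro V
    show V ∈ primedSets n I (strictSteps
      fun j => ((EnrichedSeq.ofPrimedSet i h0 hi U hU).1 j).abs) ↔ _
    rw [h1]

open Classical in
theorem card_enrichedSeq {n : ℕ} {I : Finset ℕ} (hI : I ⊆ Finset.range n) (e : ℕ →₀ ℕ)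
    [Fintype {i : FundSeq n ∅ // i.wt = e}] :
    Nat.card {a : EnrichedSeq n I // a.wt = e} =
      ∑ x : {i : FundSeq n ∅ // i.wt = e},
        if PeakGood n I (strictSteps x.1.1) then 2 ^ (strictSteps x.1.1).card else 0 := by
  rw [Nat.card_congr (enrichedSeqEquiv n I e), Nat.card_sigma]
  refine Finset.sum_congr rfl fun x _ => ?_
  rw [Nat.card_eq_fintype_card, Fintype.card_coe, card_primedSets hI (strictSteps_subset _)]

theorem EnrichedSeq.finite_wt_eq (n : ℕ) (I : Finset ℕ) (e : ℕ →₀ ℕ) :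
    Finite {a : EnrichedSeq n I // a.wt = e} := by
  have := FundSeq.finite_wt_eq n ∅ e
  exact Finite.of_equiv _ (enrichedSeqEquiv n I e).symm

/-! ### The peak function as a generating function of enriched sequences -/

-- All the `fundB n J` are counted over one index set, the weakly increasing sequences `FundSeq n
-- ∅`, so that sums over `J` can be exchanged with sums over sequences.
open Classical in
theorem coeff_fundB {n : ℕ} {J : Finset ℕ} (hJ : J ⊆ Finset.range n) (e : ℕ →₀ ℕ)
    [Fintype {i : FundSeq n ∅ // i.wt = e}] :
    MvPowerSeries.coeff e (fundB n J) =
      ((∑ x : {i : FundSeq n ∅ // i.wt = e},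
        if J ⊆ strictSteps x.1.1 then 1 else 0 : ℕ) : ℤ) := by
  change ((Nat.card _ : ℕ) : ℤ) = _
  congr 1
  rw [← Finset.card_filter, ← Fintype.card_subtype, ← Nat.card_eq_fintype_card]
  refine Nat.card_congr ⟨fun i => ⟨⟨⟨i.1.1, i.1.2.1, i.1.2.2.1, by simp⟩, i.2⟩,
    (subset_strictSteps_iff hJ).2 i.1.2.2.2⟩, fun x => ⟨⟨x.1.1.1, x.1.1.2.1, x.1.1.2.2.1,
    (subset_strictSteps_iff hJ).1 x.2⟩, x.1.2⟩, fun _ => rfl, fun _ => rfl⟩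

theorem coeff_two_pow_mul_sum_fundB {n : ℕ} (k : ℕ) (p : Finset ℕ → Prop) [DecidablePred p]
    (e : ℕ →₀ ℕ)
    [Fintype {i : FundSeq n ∅ // i.wt = e}] :
    MvPowerSeries.coeff e (2 ^ k * ∑ J ∈ (Finset.range n).powerset with p J, fundB n J) =
      ((∑ x : {i : FundSeq n ∅ // i.wt = e},
        2 ^ k * ((strictSteps x.1.1).powerset.filter p).card : ℕ) : ℤ) := by
  classical
  have h2 : (2 ^ k : MvPowerSeries ℕ ℤ) = ((2 ^ k : ℕ) : MvPowerSeries ℕ ℤ) := by push_cast; rfl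
  rw [h2, ← nsmul_eq_mul, map_nsmul, map_sum, nsmul_eq_mul]
  rw [Finset.sum_congr rfl fun J hJ => coeff_fundB
    (Finset.mem_powerset.1 (Finset.mem_filter.1 hJ).1) e, ← Nat.cast_sum, ← Nat.cast_mul]
  congr 1
  rw [Finset.sum_comm, ← Finset.mul_sum]
  congr 1
  refine Finset.sum_congr rfl fun x _ => ?_
  rw [← Finset.card_filter, Finset.filter_filter]
  congr 1
  ext J
  simp only [Finset.mem_filter, Finset.mem_powerset]
  have := strictSteps_subset x.1.1
  constructor
  · rintro ⟨_, h1, h2⟩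
    exact ⟨h2, h1⟩
  · rintro ⟨h1, h2⟩
    exact ⟨h1.trans this, h2, h1⟩

/-- For each sequence of absolute values, the weighted number of compatible `J` and the number of
admissible sets of primes are given by the same formula. -/
theorem coeff_deltaB {n : ℕ} {I : Finset ℕ} (hI : I ⊆ Finset.range n) (e : ℕ →₀ ℕ) :
    MvPowerSeries.coeff e (deltaB n I) =
      (Nat.card {a : EnrichedSeq n I // a.wt = e} : ℤ) := by
  classical
  have := FundSeq.finite_wt_eq n ∅ e
  have := Fintype.ofFinite {i : FundSeq n ∅ // i.wt = e}
  rw [card_enrichedSeq hI]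
  unfold deltaB
  split_ifs with h0
  · unfold peakFun1
    rw [coeff_two_pow_mul_sum_fundB]
    congr 1
    refine Finset.sum_congr rfl fun x _ => ?_
    convert card_compatible_one h0
  · unfold peakFun0
    rw [coeff_two_pow_mul_sum_fundB]
    congr 1
    refine Finset.sum_congr rfl fun x _ => ?_
    convert card_compatible_zero h0

/-! ### Geometry of dominoes -/

/-- `e` is strictly to the right of `d`. -/
def StrictlyRight (e d : Cells) : Prop := ∀ c ∈ d, ∀ c' ∈ e, c.2 < c'.2

/-- The sum of the row indices of the cells. -/
def rowSum (d : Cells) : ℕ := ∑ c ∈ d, c.1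

/-- The sum of the column indices of the cells. -/
def colSum (d : Cells) : ℕ := ∑ c ∈ d, c.2

theorem rowSum_horizontal (i j : ℕ) : rowSum {(i, j), (i, j + 1)} = i + i := by
  simp [rowSum]

theorem rowSum_vertical (i j : ℕ) : rowSum {(i, j), (i + 1, j)} = i + (i + 1) := by
  simp [rowSum]

theorem colSum_horizontal (i j : ℕ) : colSum {(i, j), (i, j + 1)} = j + (j + 1) := by
  simp [colSum]

theorem colSum_vertical (i j : ℕ) : colSum {(i, j), (i + 1, j)} = j + j := by
  simp [colSum]

variable {d e f : Cells}

theorem IsDomino.nonempty (hd : IsDomino d) : d.Nonempty := by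
  rcases hd with ⟨i, j, rfl⟩ | ⟨i, j, rfl⟩ <;> exact ⟨(i, j), by simp⟩

theorem not_isHorizontal_and_isVertical : ¬ (IsHorizontal d ∧ IsVertical d) := by
  rintro ⟨⟨i, j, rfl⟩, i', j', h⟩
  have h1 := congrArg rowSum h
  rw [rowSum_horizontal, rowSum_vertical] at h1
  omega

/-- Dominoes without a common row occupy disjoint intervals of rows, so a single number decides
which is lower. This is what makes row and column sums usable as sorting keys. -/
theorem strictlyLower_of_rowSum_lt (hd : IsDomino d) (he : IsDomino e) (h : ¬ ShareRow d e)
    (hlt : rowSum d < rowSum e) : StrictlyLower e d := by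
  have h' : ∀ c ∈ d, ∀ c' ∈ e, c.1 ≠ c'.1 := fun c hc c' hc' heq => h ⟨c, hc, c', hc', heq⟩
  unfold StrictlyLower
  rcases hd with ⟨i, j, rfl⟩ | ⟨i, j, rfl⟩ <;> rcases he with ⟨i', j', rfl⟩ | ⟨i', j', rfl⟩ <;>
    simp only [rowSum_horizontal, rowSum_vertical, Finset.mem_insert, Finset.mem_singleton,
      forall_eq_or_imp, forall_eq] at * <;> omega

theorem strictlyRight_of_colSum_lt (hd : IsDomino d) (he : IsDomino e) (h : ¬ ShareColumn d e)
    (hlt : colSum d < colSum e) : StrictlyRight e d := by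
  have h' : ∀ c ∈ d, ∀ c' ∈ e, c.2 ≠ c'.2 := fun c hc c' hc' heq => h ⟨c, hc, c', hc', heq⟩
  unfold StrictlyRight
  rcases hd with ⟨i, j, rfl⟩ | ⟨i, j, rfl⟩ <;> rcases he with ⟨i', j', rfl⟩ | ⟨i', j', rfl⟩ <;>
    simp only [colSum_horizontal, colSum_vertical, Finset.mem_insert, Finset.mem_singleton,
      forall_eq_or_imp, forall_eq] at * <;> omega

theorem StrictlyLower.rowSum_lt (hd : IsDomino d) (he : IsDomino e) (h : StrictlyLower e d) :
    rowSum d < rowSum e := by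
  unfold StrictlyLower at h
  rcases hd with ⟨i, j, rfl⟩ | ⟨i, j, rfl⟩ <;> rcases he with ⟨i', j', rfl⟩ | ⟨i', j', rfl⟩ <;>
    simp only [rowSum_horizontal, rowSum_vertical, Finset.mem_insert, Finset.mem_singleton,
      forall_eq_or_imp, forall_eq] at * <;> omega

theorem StrictlyRight.colSum_lt (hd : IsDomino d) (he : IsDomino e) (h : StrictlyRight e d) :
    colSum d < colSum e := by
  unfold StrictlyRight at h
  rcases hd with ⟨i, j, rfl⟩ | ⟨i, j, rfl⟩ <;> rcases he with ⟨i', j', rfl⟩ | ⟨i', j', rfl⟩ <;>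
    simp only [colSum_horizontal, colSum_vertical, Finset.mem_insert, Finset.mem_singleton,
      forall_eq_or_imp, forall_eq] at * <;> omega

theorem StrictlyLower.trans (he : IsDomino e) (h : StrictlyLower e d) (h' : StrictlyLower f e) :
    StrictlyLower f d := by
  obtain ⟨x, hx⟩ := he.nonempty
  exact fun c hc c' hc' => (h c hc x hx).trans (h' x hx c' hc')

theorem StrictlyRight.trans (he : IsDomino e) (h : StrictlyRight e d) (h' : StrictlyRight f e) :
    StrictlyRight f d := by
  obtain ⟨x, hx⟩ := he.nonempty
  exact fun c hc c' hc' => (h c hc x hx).trans (h' x hx c' hc')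

theorem strictlyRight_or_strictlyRight (hd : IsDomino d) (he : IsDomino e)
    (h : ¬ ShareColumn d e) : StrictlyRight e d ∨ StrictlyRight d e := by
  have h' : ∀ c ∈ d, ∀ c' ∈ e, c.2 ≠ c'.2 := fun c hc c' hc' heq => h ⟨c, hc, c', hc', heq⟩
  unfold StrictlyRight
  rcases hd with ⟨i, j, rfl⟩ | ⟨i, j, rfl⟩ <;> rcases he with ⟨i', j', rfl⟩ | ⟨i', j', rfl⟩ <;>
    simp only [Finset.mem_insert, Finset.mem_singleton, forall_eq_or_imp, forall_eq] at * <;>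
    omega

theorem strictlyLower_or_strictlyLower (hd : IsDomino d) (he : IsDomino e)
    (h : ¬ ShareRow d e) : StrictlyLower e d ∨ StrictlyLower d e := by
  have h' : ∀ c ∈ d, ∀ c' ∈ e, c.1 ≠ c'.1 := fun c hc c' hc' heq => h ⟨c, hc, c', hc', heq⟩
  unfold StrictlyLower
  rcases hd with ⟨i, j, rfl⟩ | ⟨i, j, rfl⟩ <;> rcases he with ⟨i', j', rfl⟩ | ⟨i', j', rfl⟩ <;>
    simp only [Finset.mem_insert, Finset.mem_singleton, forall_eq_or_imp, forall_eq] at * <;>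
    omega

/-- A vertical domino lies entirely in the shared column and a horizontal one in a single row, so
the order within the shared column settles the order of all rows. -/
theorem strictlyLower_or_aboveInColumn (hd : IsDomino d) (he : IsDomino e) (hde : Disjoint d e)
    (h : ShareColumn d e) : StrictlyLower e d ∨ AboveInColumn e d := by
  rw [or_iff_not_imp_right]
  intro hn
  have h1 : ∀ c ∈ e, ∀ c' ∈ d, c.2 = c'.2 → c'.1 ≤ c.1 := fun c hc c' hc' heq =>
    not_lt.1 fun hlt => hn ⟨c, hc, c', hc', heq, hlt⟩
  have h2 : ∀ c ∈ e, ∀ c' ∈ d, c.2 = c'.2 → c.1 ≠ c'.1 := fun c hc c' hc' heq heq' =>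
    Finset.disjoint_left.1 hde hc' (Prod.ext heq' heq ▸ hc)
  obtain ⟨c, hc, c', hc', heq⟩ := h
  unfold StrictlyLower
  rcases hd with ⟨i, j, rfl⟩ | ⟨i, j, rfl⟩ <;> rcases he with ⟨i', j', rfl⟩ | ⟨i', j', rfl⟩ <;>
    simp only [Finset.mem_insert, Finset.mem_singleton, forall_eq_or_imp, forall_eq] at * <;>
    rcases hc with rfl | rfl <;> rcases hc' with rfl | rfl <;> simp only at heq <;> omega

theorem WeaklyAboveDiagonal.exists_top (hd : IsDomino d) (h : WeaklyAboveDiagonal d) :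
    ∃ c ∈ d, c.1 ≤ c.2 ∧ ∀ c' ∈ d, c.1 ≤ c'.1 := by
  obtain ⟨c, hc, hle⟩ := h
  rcases hd with ⟨i, j, rfl⟩ | ⟨i, j, rfl⟩
  · refine ⟨c, hc, hle, ?_⟩
    simp only [Finset.mem_insert, Finset.mem_singleton, forall_eq_or_imp, forall_eq] at *
    rcases hc with rfl | rfl <;> simp
  · refine ⟨(i, j), by simp, ?_⟩
    simp only [Finset.mem_insert, Finset.mem_singleton, forall_eq_or_imp, forall_eq] at *
    rcases hc with rfl | rfl <;> simp only at * <;> omega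

/-! ### Upper parts of tilings -/

section UpperPart

variable {lam : YoungDiagram} {s : Finset Cells}

theorem mem_upperDominoes {t : Finset Cells} :
    d ∈ upperDominoes t ↔ d ∈ t ∧ WeaklyAboveDiagonal d := by
  classical
  simp [upperDominoes]

theorem IsUpperPart.isDomino (hs : IsUpperPart lam s) (hd : d ∈ s) : IsDomino d := by
  obtain ⟨t, ht, rfl⟩ := hs
  exact ht.1.1 d (mem_upperDominoes.1 hd).1

theorem IsUpperPart.weaklyAbove (hs : IsUpperPart lam s) (hd : d ∈ s) :
    WeaklyAboveDiagonal d := by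
  obtain ⟨t, ht, rfl⟩ := hs
  exact (mem_upperDominoes.1 hd).2

theorem IsUpperPart.disjoint (hs : IsUpperPart lam s) (hd : d ∈ s) (he : e ∈ s) (hne : d ≠ e) :
    Disjoint d e := by
  obtain ⟨t, ht, rfl⟩ := hs
  exact ht.1.2.1 (mem_upperDominoes.1 hd).1 (mem_upperDominoes.1 he).1 hne

/-- The cell belongs to the Young diagram, hence to some tile, and that tile is weakly above the
diagonal because of this very cell. -/
theorem IsUpperPart.exists_mem (hs : IsUpperPart lam s) (hd : d ∈ s) {r c r' c' : ℕ}
    (hrc : (r, c) ∈ d) (hr : r' ≤ r) (hc : c' ≤ c) (hup : r' ≤ c') :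
    ∃ g ∈ s, (r', c') ∈ g := by
  obtain ⟨t, ht, rfl⟩ := hs
  have hmem : (r, c) ∈ lam := by
    rw [← YoungDiagram.mem_cells, ← ht.1.2.2]
    exact Finset.mem_biUnion.2 ⟨d, (mem_upperDominoes.1 hd).1, hrc⟩
  have hmem' := lam.up_left_mem hr hc hmem
  rw [← YoungDiagram.mem_cells, ← ht.1.2.2] at hmem'
  obtain ⟨g, hg, hgm⟩ := Finset.mem_biUnion.1 hmem'
  exact ⟨g, mem_upperDominoes.2 ⟨hg, _, hgm, hup⟩, hgm⟩

/-- A filling that weakly increases along rows and columns weakly increases towards the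
southeast. -/
theorem IsUpperPart.entry_le (hs : IsUpperPart lam s) {α : Type*} [Preorder α]
    {entry : {d // d ∈ s} → α}
    (hrow : ∀ d e : {d // d ∈ s}, LeftInRow d.1 e.1 → entry d ≤ entry e)
    (hcol : ∀ d e : {d // d ∈ s}, AboveInColumn d.1 e.1 → entry d ≤ entry e)
    {g d : {d // d ∈ s}} {r c r' c' : ℕ} (hg : (r', c') ∈ g.1) (hd : (r, c) ∈ d.1)
    (hup : r' ≤ c') (hr : r' ≤ r) (hc : c' ≤ c) : entry g ≤ entry d := by
  -- Go along row `r'` to the corner cell `(r', c)`, then down column `c`.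
  obtain ⟨x, hx, hxm⟩ := hs.exists_mem d.2 hd hr le_rfl (hup.trans hc)
  have heq : ∀ y z : {d // d ∈ s}, ∀ p ∈ y.1, p ∈ z.1 → y = z := by
    intro y z p hy hz
    by_contra hne
    exact Finset.disjoint_left.1 (hs.disjoint y.2 z.2 fun h => hne (Subtype.ext h)) hy hz
  have h1 : entry g ≤ entry ⟨x, hx⟩ := by
    rcases hc.eq_or_lt with rfl | hlt
    · rw [heq g ⟨x, hx⟩ _ hg hxm]
    · exact hrow g ⟨x, hx⟩ ⟨_, hg, _, hxm, rfl, hlt⟩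
  refine h1.trans ?_
  rcases hr.eq_or_lt with rfl | hlt
  · rw [heq d ⟨x, hx⟩ _ hd hxm]
  · exact hcol ⟨x, hx⟩ d ⟨_, hxm, _, hd, rfl, hlt⟩

end UpperPart

/-! ### Ranks in a finite set -/

section Rank

variable {α β : Type*} [Fintype α] [LinearOrder β]

/-- The rank of `x` in `α`, starting from `1`, when `α` is ordered by the values of `κ`. -/
def rankBy (κ : α → β) (x : α) : ℕ := (Finset.univ.filter fun y => κ y ≤ κ x).card

theorem rankBy_lt_iff {κ : α → β} {x y : α} : rankBy κ x < rankBy κ y ↔ κ x < κ y := by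
  have mono : ∀ {x y : α}, κ x ≤ κ y → rankBy κ x ≤ rankBy κ y := fun h =>
    Finset.card_le_card fun z hz => by
      rw [Finset.mem_filter] at hz ⊢
      exact ⟨hz.1, hz.2.trans h⟩
  constructor
  · intro h
    by_contra h'
    exact absurd (mono (not_lt.1 h')) (not_le.2 h)
  · intro h
    refine Finset.card_lt_card ⟨fun z hz => ?_, fun hsub => ?_⟩
    · rw [Finset.mem_filter] at hz ⊢
      exact ⟨hz.1, hz.2.trans h.le⟩
    · have := hsub (Finset.mem_filter.2 ⟨Finset.mem_univ y, le_rfl⟩)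
      exact absurd (Finset.mem_filter.1 this).2 (not_le.2 h)

theorem rankBy_injective {κ : α → β} (hκ : Function.Injective κ) :
    Function.Injective (rankBy κ) := by
  intro x y h
  apply hκ
  apply le_antisymm <;> rw [← not_lt, ← rankBy_lt_iff] <;> omega

theorem range_eq_Icc_of_injective {m : ℕ} {q : α → ℕ} (hq : Function.Injective q)
    (h : ∀ x, q x ∈ Finset.Icc 1 m) (hm : Fintype.card α = m) :
    Set.range q = Set.Icc 1 m := by
  have : Finset.univ.image q = Finset.Icc 1 m := by
    apply Finset.eq_of_subset_of_card_le
    · intro y hy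
      obtain ⟨x, _, rfl⟩ := Finset.mem_image.1 hy
      exact h x
    · rw [Finset.card_image_of_injective _ hq, Finset.card_univ, Nat.card_Icc, hm]
      omega
  rw [← Finset.coe_Icc, ← this, Finset.coe_image, Finset.coe_univ, Set.image_univ]

theorem range_rankBy {κ : α → β} (hκ : Function.Injective κ) :
    Set.range (rankBy κ) = Set.Icc 1 (Fintype.card α) := by
  refine range_eq_Icc_of_injective (rankBy_injective hκ) (fun x => ?_) rfl
  rw [Finset.mem_Icc]
  refine ⟨Finset.card_pos.2 ⟨x, by simp⟩, ?_⟩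
  exact (Finset.card_le_univ _)

/-- A bijection onto `[1, m]` that is compatible with `κ` is the rank function. -/
theorem eq_rankBy {κ : α → β} {q : α → ℕ} {m : ℕ} (hq : Function.Injective q)
    (hrange : Set.range q = Set.Icc 1 m) (h : ∀ x y, q x < q y → κ x < κ y) : q = rankBy κ := by
  funext x
  have hiff : ∀ y, κ y ≤ κ x ↔ q y ≤ q x := by
    intro y
    constructor
    · intro hy
      by_contra hlt
      exact absurd (h x y (not_le.1 hlt)) (not_lt.2 hy)
    · intro hy
      rcases hy.eq_or_lt with heq | hlt
      · rw [hq heq]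
      · exact (h y x hlt).le
  have hx : q x ∈ Set.Icc 1 m := hrange ▸ Set.mem_range_self x
  unfold rankBy
  have himage : (Finset.univ.filter fun y => κ y ≤ κ x).image q = Finset.Icc 1 (q x) := by
    ext k
    simp only [Finset.mem_image, Finset.mem_filter, Finset.mem_univ, true_and, hiff,
      Finset.mem_Icc]
    constructor
    · rintro ⟨y, hy, rfl⟩
      have : q y ∈ Set.Icc 1 m := hrange ▸ Set.mem_range_self y
      exact ⟨this.1, hy⟩
    · rintro ⟨h1, h2⟩
      have : k ∈ Set.range q := hrange ▸ ⟨h1, h2.trans hx.2⟩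
      obtain ⟨y, rfl⟩ := this
      exact ⟨y, h2, rfl⟩
  rw [← Finset.card_image_of_injective _ hq, himage, Nat.card_Icc]
  omega

end Rank

/-! ### Standard tableaux with enriched sequences -/

namespace SShDT

variable {lam : YoungDiagram} (Q : SShDT lam)

theorem entry_mem (d : {d // d ∈ Q.dominoes}) : 1 ≤ Q.entry d ∧ Q.entry d ≤ Q.size := by
  have h : Q.entry d ∈ Set.Icc 1 Q.dominoes.card := Q.range_eq ▸ Set.mem_range_self d
  exact h

theorem exists_entry {k : ℕ} (h1 : 1 ≤ k) (h2 : k ≤ Q.size) : ∃ d, Q.entry d = k := by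
  have h : k ∈ Set.range Q.entry := Q.range_eq ▸ (⟨h1, h2⟩ : k ∈ Set.Icc 1 Q.dominoes.card)
  exact h

theorem row_weak (d e : {d // d ∈ Q.dominoes}) (h : LeftInRow d.1 e.1) :
    Q.entry d ≤ Q.entry e := by
  by_cases hde : d = e
  · rw [hde]
  · exact (Q.row_strict d e hde h).le

theorem column_weak (d e : {d // d ∈ Q.dominoes}) (h : AboveInColumn d.1 e.1) :
    Q.entry d ≤ Q.entry e := by
  by_cases hde : d = e
  · rw [hde]
  · exact (Q.column_strict d e hde h).le

theorem des_subset : Q.des ⊆ Finset.range Q.size := by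
  classical
  intro i hi
  unfold des at hi
  exact (Finset.mem_filter.1 hi).1

theorem mem_des {i : ℕ} : i ∈ Q.des ↔ i < Q.size ∧ Q.IsDescent i := by
  classical
  simp [des]

variable {Q} {d e : {d // d ∈ Q.dominoes}}

theorem entry_mem_des_iff (h : Q.entry e = Q.entry d + 1) :
    Q.entry d ∈ Q.des ↔ StrictlyLower e.1 d.1 := by
  rw [mem_des]
  have hd := Q.entry_mem d
  have he := Q.entry_mem e
  constructor
  · rintro ⟨_, ⟨h0, _⟩ | ⟨_, x, y, hx, hy, hxy⟩⟩
    · omega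
    · rwa [Q.injective hx, Q.injective (hy.trans h.symm)] at hxy
  · exact fun hl => ⟨by omega, Or.inr ⟨by omega, d, e, rfl, h, hl⟩⟩

theorem zero_mem_des_iff (h : Q.entry d = 1) : 0 ∈ Q.des ↔ IsVertical d.1 := by
  rw [mem_des]
  have hd := Q.entry_mem d
  constructor
  · rintro ⟨_, ⟨_, x, hx, hv⟩ | ⟨h0, _⟩⟩
    · rwa [Q.injective (hx.trans h.symm)] at hv
    · omega
  · exact fun hv => ⟨by omega, Or.inl ⟨rfl, d, h, hv⟩⟩

theorem entry_northwest (h : (0, 0) ∈ d.1) : Q.entry d = 1 := by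
  have hd := Q.entry_mem d
  obtain ⟨f, hf⟩ := Q.exists_entry le_rfl (hd.1.trans hd.2)
  obtain ⟨⟨r, c⟩, hrc⟩ := (Q.isUpperPart.isDomino f.2).nonempty
  have := Q.isUpperPart.entry_le Q.row_weak Q.column_weak h hrc le_rfl (Nat.zero_le _)
    (Nat.zero_le _)
  omega

/-- Otherwise `e` would be above `d` in a common column, or northwest of `d`; either way its entry
could not exceed that of `d`. -/
theorem strictlyRight_of_not_mem_des (h : Q.entry e = Q.entry d + 1)
    (hdes : Q.entry d ∉ Q.des) : StrictlyRight e.1 d.1 := by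
  rw [entry_mem_des_iff h] at hdes
  have hne : d ≠ e := by
    rintro rfl
    omega
  have hd := Q.isUpperPart.isDomino d.2
  have he := Q.isUpperPart.isDomino e.2
  by_cases hsc : ShareColumn d.1 e.1
  · rcases strictlyLower_or_aboveInColumn hd he
      (Q.isUpperPart.disjoint d.2 e.2 fun h => hne (Subtype.ext h)) hsc with h' | h'
    · exact absurd h' hdes
    · have := Q.column_strict e d hne.symm h'
      omega
  · rcases strictlyRight_or_strictlyRight hd he hsc with h' | h'
    · exact h'
    · exfalso
      unfold StrictlyLower at hdes
      push Not at hdes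
      obtain ⟨⟨r, c⟩, hx, y, hy, hle⟩ := hdes
      -- A top cell of `e` that is weakly above the diagonal is needed, so that the path from it to
      -- the cell of `d` stays in the upper part.
      obtain ⟨⟨r', c'⟩, hz, hup, htop⟩ := (Q.isUpperPart.weaklyAbove e.2).exists_top he
      have := Q.isUpperPart.entry_le Q.row_weak Q.column_weak hz hx hup ((htop y hy).trans hle)
        (h' _ hz _ hx).le
      omega

/-- A transitive relation that holds between the dominoes with consecutive entries `k`, `k + 1`
for all `k` in an interval holds between the dominoes with its end points as entries. -/
theorem rel_of_consecutive {R : {d // d ∈ Q.dominoes} → {d // d ∈ Q.dominoes} → Prop}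
    (htrans : ∀ x y z, R x y → R y z → R x z) (hlt : Q.entry d < Q.entry e)
    (h : ∀ x y, Q.entry d ≤ Q.entry x → Q.entry y ≤ Q.entry e → Q.entry y = Q.entry x + 1 →
      R x y) : R d e := by
  obtain ⟨n, hn⟩ := Nat.exists_eq_add_of_lt hlt
  induction n generalizing e with
  | zero => exact h d e le_rfl le_rfl (by omega)
  | succ n ih =>
    have hd := Q.entry_mem d
    have he := Q.entry_mem e
    obtain ⟨f, hf⟩ := Q.exists_entry (k := Q.entry d + n + 1) (by omega) (by omega)
    refine htrans d f e (ih (by omega) (fun x y hx hy hxy => ?_) hf)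
      (h f e (by omega) le_rfl (by omega))
    exact h x y hx (by omega) hxy

/-- The letter that an enriched sequence assigns to a domino of `Q`. -/
def letter (a : EnrichedSeq Q.size Q.des) (d : {d // d ∈ Q.dominoes}) : Letter :=
  a.1 ⟨Q.entry d, Nat.lt_succ_of_le (Q.entry_mem d).2⟩

variable {a : EnrichedSeq Q.size Q.des}

theorem letter_mono (h : Q.entry d ≤ Q.entry e) : letter a d ≤ letter a e :=
  a.monotone h

theorem not_mem_des_of_unprimed {k : ℕ} (h : Q.entry e = Q.entry d + 1)
    (hd : letter a d = Letter.unprimed k) (he : letter a e = Letter.unprimed k) :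
    Q.entry d ∉ Q.des := by
  have hlt : Q.entry d < Q.size := by
    have := Q.entry_mem e
    omega
  refine (a.2.2 ⟨Q.entry d, hlt⟩).2.1 k hd ?_
  rw [← he]
  exact congrArg a.1 (Fin.ext h.symm)

theorem mem_des_of_primed {k : ℕ+} (h : Q.entry e = Q.entry d + 1)
    (hd : letter a d = Letter.primed k) (he : letter a e = Letter.primed k) :
    Q.entry d ∈ Q.des := by
  have hlt : Q.entry d < Q.size := by
    have := Q.entry_mem e
    omega
  refine (a.2.2 ⟨Q.entry d, hlt⟩).2.2 k hd ?_
  rw [← he]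
  exact congrArg a.1 (Fin.ext h.symm)

/-- By monotonicity all intermediate dominoes carry the same letter, so there is no descent on the
way and the dominoes move right at each step. -/
theorem strictlyRight_of_unprimed {k : ℕ} (hlt : Q.entry d < Q.entry e)
    (hd : letter a d = Letter.unprimed k) (he : letter a e = Letter.unprimed k) :
    StrictlyRight e.1 d.1 := by
  refine rel_of_consecutive (R := fun x y => StrictlyRight y.1 x.1)
    (fun x y z h h' => h.trans (Q.isUpperPart.isDomino y.2) h') hlt fun x y hx hy hxy => ?_
  refine strictlyRight_of_not_mem_des hxy (not_mem_des_of_unprimed (a := a) (k := k) hxy ?_ ?_)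
  · exact le_antisymm (he ▸ letter_mono (by omega)) (hd ▸ letter_mono hx)
  · exact le_antisymm (he ▸ letter_mono hy) (hd ▸ letter_mono (by omega))

theorem strictlyLower_of_primed {k : ℕ+} (hlt : Q.entry d < Q.entry e)
    (hd : letter a d = Letter.primed k) (he : letter a e = Letter.primed k) :
    StrictlyLower e.1 d.1 := by
  refine rel_of_consecutive (R := fun x y => StrictlyLower y.1 x.1)
    (fun x y z h h' => h.trans (Q.isUpperPart.isDomino y.2) h') hlt fun x y hx hy hxy => ?_
  refine (entry_mem_des_iff hxy).1 (mem_des_of_primed (a := a) (k := k) hxy ?_ ?_)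
  · exact le_antisymm (he ▸ letter_mono (by omega)) (hd ▸ letter_mono hx)
  · exact le_antisymm (he ▸ letter_mono hy) (hd ▸ letter_mono (by omega))

/-- The semistandard tableau obtained from a standard one by relabelling. -/
def relabel (Q : SShDT lam) (a : EnrichedSeq Q.size Q.des) : SSShDT lam where
  dominoes := Q.dominoes
  isUpperPart := Q.isUpperPart
  entry := letter a
  row_weak d e h := letter_mono (Q.row_weak d e h)
  column_weak d e h := letter_mono (Q.column_weak d e h)
  row_primed k d e h hd he := by
    obtain ⟨c, hc, c', hc', heq⟩ := h
    rcases lt_trichotomy (Q.entry d) (Q.entry e) with hlt | hq | hlt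
    · exact absurd heq (strictlyLower_of_primed hlt hd he c hc c' hc').ne
    · exact Q.injective hq
    · exact absurd heq (strictlyLower_of_primed hlt he hd c' hc' c hc).ne'
  column_unprimed k d e h hd he := by
    obtain ⟨c, hc, c', hc', heq⟩ := h
    rcases lt_trichotomy (Q.entry d) (Q.entry e) with hlt | hq | hlt
    · exact absurd heq (strictlyRight_of_unprimed hlt hd he c hc c' hc').ne
    · exact Q.injective hq
    · exact absurd heq (strictlyRight_of_unprimed hlt he hd c' hc' c hc).ne'
  northwest_zero d h hd := by
    have h1 := entry_northwest h
    have hlt : 0 < Q.size := by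
      have := Q.entry_mem d
      omega
    -- The step from the initial letter 0 to the letter 0 of the first domino is an unprimed tie at
    -- position 0.
    have h0 : 0 ∉ Q.des := by
      refine (a.2.2 ⟨0, hlt⟩).2.1 0 a.2.1 (Eq.trans ?_ hd)
      exact congrArg a.1 (Fin.ext h1.symm)
    rw [zero_mem_des_iff h1] at h0
    exact (Q.isUpperPart.isDomino d.2).resolve_right h0

theorem wt_relabel (a : EnrichedSeq Q.size Q.des) : (Q.relabel a).wt = a.wt := by
  unfold SSShDT.wt EnrichedSeq.wt
  refine Fintype.sum_bijective
    (fun d : {d // d ∈ Q.dominoes} => (⟨Q.entry d - 1, by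
      have := Q.entry_mem d
      omega⟩ : Fin Q.size)) ⟨fun d e h => ?_, fun j => ?_⟩ _ _ fun d => ?_
  · have h' := congrArg Fin.val h
    simp only at h'
    have := Q.entry_mem d
    have := Q.entry_mem e
    exact Q.injective (by omega)
  · obtain ⟨d, hd⟩ := Q.exists_entry (k := j + 1) (by omega) (by omega)
    exact ⟨d, Fin.ext (by simp [hd])⟩
  · have := Q.entry_mem d
    have hj : (⟨Q.entry d, Nat.lt_succ_of_le this.2⟩ : Fin (Q.size + 1)) =
        (⟨Q.entry d - 1, by omega⟩ : Fin Q.size).succ := Fin.ext (by simp; omega)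
    show Finsupp.single (a.1 _).abs 1 = _
    rw [hj]

end SShDT

/-! ### Standardization -/

/-- The sorting key of a domino with a given entry: equal unprimed entries are ordered from left
to right, equal primed ones from top to bottom. -/
def sortKey (x : Letter) (d : Cells) : Letter ×ₗ ℕ :=
  toLex (x, if x.isPrimed = true then rowSum d else colSum d)

theorem sortKey_lt_iff {x y : Letter} {d e : Cells} :
    sortKey x d < sortKey y e ↔ x < y ∨ x = y ∧
      (if x.isPrimed = true then rowSum d else colSum d) <
        (if y.isPrimed = true then rowSum e else colSum e) :=
  Prod.Lex.toLex_lt_toLex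

/-- The original order of the dominoes can be read off from the relabelled tableau, which is why
relabelling loses no information. -/
theorem SShDT.sortKey_lt {lam : YoungDiagram} {Q : SShDT lam} {a : EnrichedSeq Q.size Q.des}
    {d e : {d // d ∈ Q.dominoes}} (hlt : Q.entry d < Q.entry e) :
    sortKey (letter a d) d.1 < sortKey (letter a e) e.1 := by
  rw [sortKey_lt_iff]
  rcases (letter_mono (a := a) hlt.le).lt_or_eq with h | h
  · exact Or.inl h
  · refine Or.inr ⟨h, ?_⟩
    have hd := Q.isUpperPart.isDomino d.2
    have he := Q.isUpperPart.isDomino e.2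
    rw [← h]
    cases hx : letter a d with
    | unprimed k => exact (strictlyRight_of_unprimed hlt hx (h ▸ hx)).colSum_lt hd he
    | primed k => exact (strictlyLower_of_primed hlt hx (h ▸ hx)).rowSum_lt hd he

theorem SShDT.relabel_injective {lam : YoungDiagram} :
    Function.Injective
      (fun p : (Σ Q : SShDT lam, EnrichedSeq Q.size Q.des) => p.1.relabel p.2) := by
  rintro ⟨Q, a⟩ ⟨Q', a'⟩ h
  have key : ∀ (Q : SShDT lam) (a : EnrichedSeq Q.size Q.des),
      Q.entry = rankBy fun d => sortKey ((Q.relabel a).entry d) d.1 := fun Q a =>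
    eq_rankBy Q.injective Q.range_eq fun x y hlt => sortKey_lt hlt
  have hQ := key Q a
  have hQ' := key Q' a'
  simp only at h
  have hQQ : Q = Q' := by
    obtain ⟨s, hs, q, h1, h2, h3, h4⟩ := Q
    obtain ⟨s', hs', q', h1', h2', h3', h4'⟩ := Q'
    simp only [relabel, SSShDT.mk.injEq] at h
    obtain ⟨rfl, h⟩ := h
    have h := eq_of_heq h
    simp only [relabel] at hQ hQ'
    obtain rfl : q = q' := hQ.trans ((congrArg
      (fun l : {d // d ∈ s} → Letter => rankBy fun d => sortKey (l d) d.1) h).trans hQ'.symm)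
    rfl
  subst hQQ
  congr 1
  apply Subtype.ext
  funext j
  -- Position 0 corresponds to no domino, but its letter is prescribed.
  by_cases hj : j = 0
  · rw [hj, a.2.1, a'.2.1]
  · have := Fin.pos_iff_ne_zero.2 hj
    rw [Fin.lt_def] at this
    obtain ⟨d, hd⟩ := Q.exists_entry (k := j) this (Nat.lt_succ_iff.1 j.2)
    have hl : letter a d = letter a' d := by
      have := h
      simp only [relabel, SSShDT.mk.injEq, heq_eq_eq, true_and] at this
      exact congrFun this d
    have hj' : j = ⟨Q.entry d, Nat.lt_succ_of_le (Q.entry_mem d).2⟩ := Fin.ext hd.symm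
    rw [hj']
    exact hl

/-! ### From a semistandard tableau to a standard one and its enriched word -/

namespace SSShDT

variable {lam : YoungDiagram} (T : SSShDT lam)

/-- The sorting key of a domino of `T`. -/
def key (d : {d // d ∈ T.dominoes}) : Letter ×ₗ ℕ := sortKey (T.entry d) d.1

variable {T} {d e : {d // d ∈ T.dominoes}}

theorem not_shareRow {k : ℕ+} (hne : d ≠ e) (hd : T.entry d = Letter.primed k)
    (he : T.entry e = Letter.primed k) : ¬ ShareRow d.1 e.1 :=
  fun h => hne (T.row_primed k d e h hd he)

theorem not_shareColumn {k : ℕ} (hne : d ≠ e) (hd : T.entry d = Letter.unprimed k)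
    (he : T.entry e = Letter.unprimed k) : ¬ ShareColumn d.1 e.1 :=
  fun h => hne (T.column_unprimed k d e h hd he)

/-- Dominoes with the same unprimed (primed) letter share no column (row), so one is strictly to the
right of (below) the other and the sums differ. -/
theorem key_injective : Function.Injective T.key := by
  intro d e h
  have hd := T.isUpperPart.isDomino d.2
  have he := T.isUpperPart.isDomino e.2
  have h' : (T.entry d, if (T.entry d).isPrimed = true then rowSum d.1 else colSum d.1) =
    (T.entry e, if (T.entry e).isPrimed = true then rowSum e.1 else colSum e.1) := toLex.injective h
  rw [Prod.mk.injEq] at h'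
  obtain ⟨h1, h2⟩ := h'
  by_contra hne
  cases hx : T.entry d with
  | unprimed k =>
    have hy := h1 ▸ hx
    simp only [hx, hy, Letter.isPrimed] at h2
    rcases strictlyRight_or_strictlyRight hd he (not_shareColumn hne hx hy) with h | h
    · exact absurd h2 (h.colSum_lt hd he).ne
    · exact absurd h2 (h.colSum_lt he hd).ne'
  | primed k =>
    have hy := h1 ▸ hx
    simp only [hx, hy, Letter.isPrimed] at h2
    rcases strictlyLower_or_strictlyLower hd he (not_shareRow hne hx hy) with h | h
    · exact absurd h2 (h.rowSum_lt hd he).ne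
    · exact absurd h2 (h.rowSum_lt he hd).ne'

/-- Only ties matter. A primed tie cannot occur within a row, and an unprimed tie is broken from
left to right. -/
theorem key_lt_of_leftInRow (hne : d ≠ e) (h : LeftInRow d.1 e.1) : T.key d < T.key e := by
  have hd := T.isUpperPart.isDomino d.2
  have he := T.isUpperPart.isDomino e.2
  unfold key
  rw [sortKey_lt_iff]
  rcases (T.row_weak d e h).lt_or_eq with hlt | heq
  · exact Or.inl hlt
  · refine Or.inr ⟨heq, ?_⟩
    rw [← heq]
    obtain ⟨c, hc, c', hc', hr, hlt⟩ := h
    cases hx : T.entry d with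
    | unprimed k =>
      rcases strictlyRight_or_strictlyRight hd he (not_shareColumn hne hx (heq ▸ hx)) with h | h
      · exact h.colSum_lt hd he
      · exact absurd (h c' hc' c hc) hlt.not_gt
    | primed k => exact absurd ⟨c, hc, c', hc', hr⟩ (not_shareRow hne hx (heq ▸ hx))

theorem key_lt_of_aboveInColumn (hne : d ≠ e) (h : AboveInColumn d.1 e.1) :
    T.key d < T.key e := by
  have hd := T.isUpperPart.isDomino d.2
  have he := T.isUpperPart.isDomino e.2
  unfold key
  rw [sortKey_lt_iff]
  rcases (T.column_weak d e h).lt_or_eq with hlt | heq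
  · exact Or.inl hlt
  · refine Or.inr ⟨heq, ?_⟩
    rw [← heq]
    obtain ⟨c, hc, c', hc', hr, hlt⟩ := h
    cases hx : T.entry d with
    | unprimed k => exact absurd ⟨c, hc, c', hc', hr⟩ (not_shareColumn hne hx (heq ▸ hx))
    | primed k =>
      rcases strictlyLower_or_strictlyLower hd he (not_shareRow hne hx (heq ▸ hx)) with h | h
      · exact h.rowSum_lt hd he
      · exact absurd (h c' hc' c hc) hlt.not_gt

/-- The standardization of a semistandard tableau. -/
noncomputable def standardize (T : SSShDT lam) : SShDT lam where
  dominoes := T.dominoes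
  isUpperPart := T.isUpperPart
  entry := rankBy T.key
  injective := rankBy_injective key_injective
  range_eq := by rw [range_rankBy key_injective, Fintype.card_coe]
  row_strict _ _ hne h := rankBy_lt_iff.2 (key_lt_of_leftInRow hne h)
  column_strict _ _ hne h := rankBy_lt_iff.2 (key_lt_of_aboveInColumn hne h)

theorem sortKey_lt_of_rank_lt (h : T.standardize.entry d < T.standardize.entry e) :
    sortKey (T.entry d) d.1 < sortKey (T.entry e) e.1 :=
  rankBy_lt_iff (κ := T.key).1 h

theorem entry_le_of_rank_lt (h : T.standardize.entry d < T.standardize.entry e) :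
    T.entry d ≤ T.entry e := by
  rcases sortKey_lt_iff.1 (sortKey_lt_of_rank_lt h) with h | h
  · exact h.le
  · exact h.1.le

/-- Equal unprimed entries weakly move up from left to right. -/
theorem not_strictlyLower_of_unprimed {k : ℕ}
    (h : T.standardize.entry d < T.standardize.entry e) (hd : T.entry d = Letter.unprimed k)
    (he : T.entry e = Letter.unprimed k) : ¬ StrictlyLower e.1 d.1 := by
  intro hlow
  have hdd := T.isUpperPart.isDomino d.2
  have hde := T.isUpperPart.isDomino e.2
  have hne : d ≠ e := by
    rintro rfl
    exact lt_irrefl _ h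
  have hkey := sortKey_lt_iff.1 (sortKey_lt_of_rank_lt h)
  simp only [hd, he, lt_irrefl, false_or, true_and, Letter.isPrimed, Bool.false_eq_true,
    if_false] at hkey
  have hright := strictlyRight_of_colSum_lt hdd hde (not_shareColumn hne hd he) hkey
  obtain ⟨⟨r, c⟩, hz, hup, -⟩ := (T.isUpperPart.weaklyAbove d.2).exists_top hdd
  obtain ⟨⟨r', c'⟩, hy⟩ := hde.nonempty
  have hr := hlow _ hz _ hy
  have hc := hright _ hz _ hy
  simp only at hr hc hup
  -- The domino `g` at the corner, in the row of the top cell of `d` and the column of a cell of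
  -- `e`, has its letter squeezed to `k`. Sharing a column with `e`, it must be `e`, which then
  -- reaches a row of `d`.
  obtain ⟨g, hg, hgm⟩ := T.isUpperPart.exists_mem e.2 hy hr.le le_rfl (hup.trans hc.le)
  have h1 : T.entry d ≤ T.entry ⟨g, hg⟩ := T.row_weak d ⟨g, hg⟩ ⟨_, hz, _, hgm, rfl, hc⟩
  have h2 : T.entry ⟨g, hg⟩ ≤ T.entry e := T.column_weak ⟨g, hg⟩ e ⟨_, hgm, _, hy, rfl, hr⟩
  have h3 : T.entry ⟨g, hg⟩ = Letter.unprimed k := le_antisymm (he ▸ h2) (hd ▸ h1)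
  have h4 : (⟨g, hg⟩ : {d // d ∈ T.dominoes}) = e :=
    T.column_unprimed k _ _ ⟨_, hgm, _, hy, rfl⟩ h3 he
  rw [← h4] at hlow
  exact lt_irrefl r (hlow _ hz _ hgm)

theorem strictlyLower_of_primed {k : ℕ+}
    (h : T.standardize.entry d < T.standardize.entry e) (hd : T.entry d = Letter.primed k)
    (he : T.entry e = Letter.primed k) : StrictlyLower e.1 d.1 := by
  have hne : d ≠ e := by
    rintro rfl
    exact lt_irrefl _ h
  have hkey := sortKey_lt_iff.1 (sortKey_lt_of_rank_lt h)
  simp only [hd, he, lt_irrefl, false_or, true_and, Letter.isPrimed, if_true] at hkey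
  exact strictlyLower_of_rowSum_lt (T.isUpperPart.isDomino d.2) (T.isUpperPart.isDomino e.2)
    (not_shareRow hne hd he) hkey

open Classical in
/-- The entries of `T` in the order of its standardization, preceded by `0`. -/
noncomputable def entrySeq (T : SSShDT lam) (j : Fin (T.standardize.size + 1)) : Letter :=
  if h : ∃ d, T.standardize.entry d = j then T.entry h.choose else Letter.unprimed 0

theorem entrySeq_eq {j : Fin (T.standardize.size + 1)} {d : {d // d ∈ T.dominoes}}
    (h : T.standardize.entry d = j) : T.entrySeq j = T.entry d := by
  have hex : ∃ d, T.standardize.entry d = j := ⟨d, h⟩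
  unfold entrySeq
  rw [dif_pos hex]
  exact congrArg T.entry (T.standardize.injective (hex.choose_spec.trans h.symm))

theorem entrySeq_zero : T.entrySeq 0 = Letter.unprimed 0 := by
  unfold entrySeq
  rw [dif_neg]
  rintro ⟨d, hd⟩
  have := T.standardize.entry_mem d
  simp only [Fin.val_zero] at hd
  omega

/-- The enriched sequence of a semistandard tableau. -/
noncomputable def enrichedSeq (T : SSShDT lam) :
    EnrichedSeq T.standardize.size T.standardize.des :=
  ⟨T.entrySeq, entrySeq_zero, fun j => by
    obtain ⟨e, he⟩ := T.standardize.exists_entry (k := j + 1) (by omega) (by omega)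
    have hes : T.entrySeq j.succ = T.entry e := entrySeq_eq (he.trans (Fin.val_succ j).symm)
    rw [hes]
    -- The step at 0 starts from the artificial letter 0 and encodes the northwest rule; every other
    -- step compares two dominoes.
    by_cases hj : (j : ℕ) = 0
    · have hj0 : j.castSucc = 0 := Fin.ext hj
      have he1 : T.standardize.entry e = 1 := by omega
      rw [hj0, entrySeq_zero, hj]
      refine ⟨Letter.le_iff_rank.2 (Nat.zero_le _), fun k hk hek => ?_, fun k hk => by cases hk⟩
      cases hk
      obtain ⟨⟨r, c⟩, hrc⟩ := (T.isUpperPart.isDomino e.2).nonempty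
      -- The domino ranked 1 is the one covering `(0, 0)`, so if it carries 0 it is horizontal and 0
      -- is not a descent.
      obtain ⟨g, hg, hgm⟩ := T.isUpperPart.exists_mem e.2 hrc (Nat.zero_le r) (Nat.zero_le c)
        le_rfl
      have hge : (⟨g, hg⟩ : {d // d ∈ T.dominoes}) = e := T.standardize.injective
        ((SShDT.entry_northwest (Q := T.standardize) (d := ⟨g, hg⟩) hgm).trans he1.symm)
      rw [SShDT.zero_mem_des_iff he1]
      subst hge
      exact fun hv => not_isHorizontal_and_isVertical ⟨T.northwest_zero _ hgm hek, hv⟩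
    · obtain ⟨d, hd⟩ := T.standardize.exists_entry (k := j) (by omega) (by omega)
      have hds : T.entrySeq j.castSucc = T.entry d := entrySeq_eq hd
      have hlt : T.standardize.entry d < T.standardize.entry e := by omega
      have hdes := SShDT.entry_mem_des_iff (Q := T.standardize) (d := d) (e := e) (by omega)
      rw [hd] at hdes
      rw [hds, hdes]
      exact ⟨entry_le_of_rank_lt hlt, fun k h1 h2 => not_strictlyLower_of_unprimed hlt h1 h2,
        fun k h1 h2 => strictlyLower_of_primed hlt h1 h2⟩⟩

/-- This gives surjectivity of relabelling: the enriched word at the rank of a domino is, by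
construction, the letter of that domino. -/
theorem relabel_standardize (T : SSShDT lam) : T.standardize.relabel T.enrichedSeq = T := by
  have h : SShDT.letter T.enrichedSeq = T.entry := funext fun d => entrySeq_eq rfl
  obtain ⟨s, hs, f, h1, h2, h3, h4, h5⟩ := T
  unfold SShDT.relabel
  rw [SSShDT.mk.injEq]
  exact ⟨rfl, heq_of_eq h⟩

end SSShDT

/-- Semistandard shifted domino tableaux correspond to standard ones with an enriched sequence
for the descent set. -/
noncomputable def standardizationEquiv (lam : YoungDiagram) :
    (Σ Q : SShDT lam, EnrichedSeq Q.size Q.des) ≃ SSShDT lam :=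
  Equiv.ofBijective (fun p => p.1.relabel p.2)
    ⟨SShDT.relabel_injective, fun T => ⟨⟨T.standardize, T.enrichedSeq⟩, T.relabel_standardize⟩⟩

theorem card_SSShDT_wt_eq (lam : YoungDiagram) (e : ℕ →₀ ℕ) :
    Nat.card {T : SSShDT lam // T.wt = e} =
      ∑ Q : SShDT lam, Nat.card {a : EnrichedSeq Q.size Q.des // a.wt = e} := by
  have := fun Q : SShDT lam => EnrichedSeq.finite_wt_eq Q.size Q.des e
  rw [← Nat.card_sigma]
  refine Nat.card_congr (Equiv.trans ?_ ((standardizationEquiv lam).subtypeEquiv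
    (p := fun p => p.2.wt = e) fun p => ?_)).symm
  · exact ⟨fun x => ⟨⟨x.1, x.2.1⟩, x.2.2⟩, fun x => ⟨x.1.1, x.1.2, x.2⟩, fun _ => rfl,
      fun _ => rfl⟩
  · show p.2.wt = e ↔ (p.1.relabel p.2).wt = e
    rw [SShDT.wt_relabel]

end ShiftedDomino

theorem mainTheorem4 (lam : YoungDiagram) (hlam : ShiftedDomino.QuotientCondition lam) :
    ShiftedDomino.shiftedDominoFun lam =
      ∑ Q : ShiftedDomino.SShDT lam, ShiftedDomino.deltaB Q.size Q.des := by
  ext e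
  rw [map_sum]
  simp only [ShiftedDomino.coeff_deltaB (ShiftedDomino.SShDT.des_subset _)]
  rw [← Nat.cast_sum, ← ShiftedDomino.card_SSShDT_wt_eq]
  rfl
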